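/- Let $N\ge 1$ be an integer, $s\in(0,1)$, $\alpha\ge 0$, $C_0>0$ and $\beta\in\mathbb R$, and suppose that one of the following conditions holds: (i) $0<\beta\le N-2s$ and $\alpha\le 2$; (ii) $N-2s<\beta<N$ and $\alpha\le 2s$; (iii) $\beta=N$ and $\alpha<2s$; (iv) $\beta>N$ and $\alpha+\beta\le N+2s$. Write $\mathcal L^s(\mathbb R^N)$ for the set of functions $f:\mathbb R^N\to\mathbb R$ with $\int_{\mathbb R^N}\frac{|f(x)|}{1+|x|^{N+2s}}\,dx<\infty$, put $\psi_\beta(x)=(1+|x|^2)^{-\beta/2}$, and let $$(-\Delta)^su(x)=C_{N,s}\lim_{\varepsilon\to0^+}\int_{\{|x-y|\ge\varepsilon\}}\frac{u(x)-u(y)}{|x-y|^{N+2s}}\,dy,\qquad C_{N,s}=\frac{2^{2s-1}\,2s\,\Gamma((N+2s)/2)}{\pi^{N/2}\,\Gamma(1-s)}.$$ Then there is a constant $K$, depending only on $N,s,\alpha,\beta,C_0$, with the following property. Let $\rho,c:\mathbb R^N\to\mathbb R$ be continuous functions with $$\rho(x)\ge C_0(1+|x|^2)^{-\alpha/2}\quad\text{and}\quad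 c(x)\ge c_0\qquad\text{for all }x\in\mathbb R^N,$$ for some $c_0>0$, and let $p\in[1,\infty)$ satisfy $p\,c_0\ge K$. Let $u\in C^2(\mathbb R^N)\cap\mathcal L^s(\mathbb R^N)$ be a classical solution of $$\Delta u-(-\Delta)^su-\rho\,c\,u=0\quad\text{in }\mathbb R^N$$ (that is, the equation holds at every point) such that $|u|^p\in\mathcal L^s(\mathbb R^N)$ and $u\in L^p_{\psi_\beta}(\mathbb R^N)$, i.e. $\int_{\mathbb R^N}|u|^p\,\psi_\beta\,dx<\infty$. Then $u\equiv0$ in $\mathbb R^N$. -/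

import Mathlib

open Filter Topology MeasureTheory

/-- Membership in `𝓛^s(ℝ^N)`: `∫ |f(x)| / (1 + |x|^(N+2s)) dx < ∞`. -/
def MemLs {N : ℕ} (s : ℝ) (f : EuclideanSpace ℝ (Fin N) → ℝ) : Prop :=
  Integrable (fun x : EuclideanSpace ℝ (Fin N) => |f x| / (1 + ‖x‖ ^ ((N : ℝ) + 2 * s)))

/-- The normalization constant of the fractional Laplacian,
`C_{N,s} = 2^(2s-1) 2s Γ((N+2s)/2) / (π^(N/2) Γ(1-s))`. -/
noncomputable def fracLaplacianConst (N : ℕ) (s : ℝ) : ℝ :=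
  (2 : ℝ) ^ (2 * s - 1) * (2 * s) * Real.Gamma (((N : ℝ) + 2 * s) / 2) /
    (Real.pi ^ ((N : ℝ) / 2) * Real.Gamma (1 - s))

/-- The truncation at distance `ε` of the singular integral that defines `(-Δ)^s u (x)`.
For `u ∈ 𝓛^s(ℝ^N)` the integrand is integrable on `{|x - y| ≥ ε}` for every `ε > 0`. -/
noncomputable def fracLaplacianTrunc {N : ℕ} (s : ℝ) (u : EuclideanSpace ℝ (Fin N) → ℝ)
    (x : EuclideanSpace ℝ (Fin N)) (ε : ℝ) : ℝ :=
  fracLaplacianConst N s *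
    ∫ y in {y : EuclideanSpace ℝ (Fin N) | ε ≤ ‖x - y‖},
      (u x - u y) / ‖x - y‖ ^ ((N : ℝ) + 2 * s)

/-- `(-Δ)^s u (x)` exists as a principal value and equals `ℓ`. The sign is the one for which
`(-Δ)^s` is the positive operator with Fourier symbol `|ξ|^(2s)`. -/
def HasFracLaplacianAt {N : ℕ} (s : ℝ) (u : EuclideanSpace ℝ (Fin N) → ℝ)
    (ℓ : ℝ) (x : EuclideanSpace ℝ (Fin N)) : Prop :=
  Tendsto (fracLaplacianTrunc s u x) (𝓝[>] 0) (𝓝 ℓ)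

/-- `u` is a classical solution of `Δ u - (-Δ)^s u - ρ c u = 0` in `ℝ^N`:
`u ∈ C²(ℝ^N) ∩ 𝓛^s(ℝ^N)` and the equation holds at every point. -/
structure IsClassicalSolution {N : ℕ} (s : ℝ) (ρ c u : EuclideanSpace ℝ (Fin N) → ℝ) : Prop where
  contDiff : ContDiff ℝ 2 u
  memLs : MemLs s u
  equation : ∀ x, ∃ ℓ : ℝ, HasFracLaplacianAt s u ℓ x ∧
    (Laplacian.laplacian u : EuclideanSpace ℝ (Fin N) → ℝ) x - ℓ - ρ x * c x * u x = 0

/-- The weight `ψ_β(x) = (1 + |x|²)^(-β/2)`. -/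
noncomputable def weightPsi {N : ℕ} (β : ℝ) (x : EuclideanSpace ℝ (Fin N)) : ℝ :=
  (1 + ‖x‖ ^ 2) ^ (-β / 2)

/-- Membership in the weighted space `L^p_f(ℝ^N)`, `1 ≤ p < ∞`: `∫ |u|^p f dx < ∞`. -/
def MemWeightedLp {N : ℕ} (p : ℝ) (f u : EuclideanSpace ℝ (Fin N) → ℝ) : Prop :=
  Integrable (fun x : EuclideanSpace ℝ (Fin N) => |u x| ^ p * f x)

/-!
Put `w = |u| ^ p`. Convexity of `|·| ^ p` gives Kato's inequality
`p |u| ^ (p - 2) u (Δ - (-Δ)^s) u ≤ (Δ - (-Δ)^s) w`. Here `w` is in general not twice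
differentiable, so the inequality is used with the Laplacian replaced by second difference quotients
of step `h` and with the jumps of size at least `h` only, operators that are bounded and symmetric.
Testing with the cut-off weights `ψ_β(x) (1 - |x|² / R)₊³` moves the operator to the weight; the
limits `h → 0` and `R → ∞`, by dominated convergence, give
`p c₀ C₀ ∫ w ψ_{α+β} ≤ A ∫ w ψ_{β+2} - ∫ w (-Δ)^s ψ_β`.

Hence `u = 0` for large `p c₀` as soon as `α ≤ 2` and `-(-Δ)^s ψ_β ≤ D ψ_{α+β}`. In the cases
(ii)-(iv) the latter holds because the long range part of `(-Δ)^s ψ_β` decays like `ψ_{β+2s}` when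
`β < N`, and like `ψ_σ` for every `σ ≤ N + 2s` with `σ < β + 2s` in general. In the case (i) it
holds with `D = 0`: both `|z| ^ (-N-2s)` and `ψ_β` are mixtures of Gaussians, so that the semigroup
law of the Gaussians reduces `(-Δ)^s ψ_β ≥ 0` to an inequality between densities on the half line,
which is where `β ≤ N - 2s` enters.
-/

open Metric Set

local notation:max "ℝ^" n:max => EuclideanSpace ℝ (Fin n)

section SecondDifference

/-- The symmetric second difference of `f` at `x` with step `z`. -/
def secondDiff {G : Type*} [AddGroup G] (f : G → ℝ) (x z : G) : ℝ :=
  f (x + z) + f (x - z) - 2 * f x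

theorem secondDiff_zero {G : Type*} [AddGroup G] (f : G → ℝ) (x : G) : secondDiff f x 0 = 0 := by
  simp only [secondDiff, add_zero, sub_zero]
  ring

theorem continuous_secondDiff {G : Type*} [AddGroup G] [TopologicalSpace G]
    [IsTopologicalAddGroup G] {f : G → ℝ} (hf : Continuous f) (x : G) :
    Continuous (secondDiff f x) := by
  unfold secondDiff
  fun_prop

section Line

variable {E : Type*} [AddCommGroup E] [Module ℝ E] {f : E → ℝ} {x z : E} {g' g'' : ℝ → ℝ}

theorem secondDiff_comp_line (f : E → ℝ) (x z : E) (t : ℝ) :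
    secondDiff (fun r : ℝ => f (x + r • z)) 0 t = secondDiff f x (t • z) := by
  simp [secondDiff, sub_eq_add_neg]

theorem hasDerivAt_secondDiff_zero {g : ℝ → ℝ} {t : ℝ} (hpos : HasDerivAt g (g' t) t)
    (hneg : HasDerivAt g (g' (-t)) (-t)) :
    HasDerivAt (secondDiff g 0) (g' t - g' (-t)) t := by
  have h := (hpos.add (hneg.comp t (hasDerivAt_neg t))).sub_const (2 * g 0)
  refine (h.congr_deriv (by ring)).congr_of_eventuallyEq (.of_forall fun r => ?_)
  simp [secondDiff]

theorem abs_secondDiff_le_of_line {B : ℝ}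
    (hd : ∀ t : ℝ, |t| ≤ 1 → HasDerivAt (fun r : ℝ => f (x + r • z)) (g' t) t)
    (hd' : ∀ t : ℝ, |t| ≤ 1 → HasDerivAt g' (g'' t) t) (hB : ∀ t : ℝ, |t| ≤ 1 → |g'' t| ≤ B) :
    |secondDiff f x z| ≤ 2 * B := by
  have hB₀ : 0 ≤ B := (abs_nonneg _).trans (hB 0 (by simp))
  have hslope : ∀ t ∈ Icc (0 : ℝ) 1, |g' t - g' (-t)| ≤ 2 * B := by
    intro t ⟨ht₀, ht₁⟩
    have hmv := (convex_Icc (-1 : ℝ) 1).norm_image_sub_le_of_norm_hasDerivWithin_le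
      (fun r hr => (hd' r (abs_le.2 hr)).hasDerivWithinAt) (fun r hr => hB r (abs_le.2 hr))
      (x := -t) (y := t) ⟨by linarith, by linarith⟩ ⟨by linarith, ht₁⟩
    rw [Real.norm_eq_abs, Real.norm_eq_abs, sub_neg_eq_add,
      abs_of_nonneg (add_nonneg ht₀ ht₀)] at hmv
    nlinarith
  have hmv := (convex_Icc (0 : ℝ) 1).norm_image_sub_le_of_norm_hasDerivWithin_le
    (fun t ht => (hasDerivAt_secondDiff_zero (hd t (abs_le.2 ⟨by linarith [ht.1], ht.2⟩))
      (hd (-t) (abs_le.2 ⟨by linarith [ht.2], by linarith [ht.1]⟩))).hasDerivWithinAt)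
    hslope (x := 0) (y := 1) (by simp) (by simp)
  simpa [secondDiff_zero, secondDiff_comp_line] using hmv

theorem tendsto_secondDiff_smul_div_sq {L : ℝ}
    (hd : ∀ t : ℝ, HasDerivAt (fun r : ℝ => f (x + r • z)) (g' t) t) (hd' : HasDerivAt g' L 0) :
    Tendsto (fun t : ℝ => secondDiff f x (t • z) / t ^ 2) (𝓝[>] 0) (𝓝 L) := by
  simp_rw [← secondDiff_comp_line]
  have hderiv : ∀ t, HasDerivAt (secondDiff (fun r : ℝ => f (x + r • z)) 0) (g' t - g' (-t)) t :=
    fun t => hasDerivAt_secondDiff_zero (hd t) (hd (-t))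
  refine HasDerivAt.lhopital_zero_nhdsGT (g' := fun t => 2 * t) (.of_forall hderiv)
    (.of_forall fun t => by simpa using hasDerivAt_pow 2 t) ?_ ?_ ?_ ?_
  · filter_upwards [self_mem_nhdsWithin] with t (ht : 0 < t)
    positivity
  · have h := (hderiv 0).continuousAt.tendsto
    rw [secondDiff_zero] at h
    exact h.mono_left nhdsWithin_le_nhds
  · have h := ((continuous_pow 2).tendsto (0 : ℝ)).mono_left (nhdsWithin_le_nhds (s := Ioi 0))
    simpa using h
  · have hslope : HasDerivAt (fun t => g' t - g' (-t)) (2 * L) 0 := by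
      have hneg : HasDerivAt (fun t => g' (-t)) (L * -1) 0 :=
        HasDerivAt.comp 0 (by simpa using hd') (hasDerivAt_neg 0)
      exact (hd'.sub hneg).congr_deriv (by ring)
    have h := ((hasDerivAt_iff_tendsto_slope.1 hslope).mono_left
      (nhdsWithin_mono 0 fun t (ht : 0 < t) => ht.ne')).div_const 2
    rw [mul_div_cancel_left₀ L two_ne_zero] at h
    refine h.congr fun t => ?_
    rw [slope_def_field, neg_zero, sub_self, sub_zero, sub_zero, div_div, mul_comm t 2]

end Line

section ContDiff

variable {E : Type*} [NormedAddCommGroup E]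

theorem hasDerivAt_line [NormedSpace ℝ E] (x z : E) (t : ℝ) :
    HasDerivAt (fun r : ℝ => x + r • z) z t := by
  simpa using ((hasDerivAt_id t).smul_const z).const_add x

section

variable [NormedSpace ℝ E] {u : E → ℝ}

theorem hasDerivAt_comp_line (hu : ContDiff ℝ 2 u) (x z : E) (t : ℝ) :
    HasDerivAt (fun r : ℝ => u (x + r • z)) (fderiv ℝ u (x + t • z) z) t :=
  (hu.differentiable two_ne_zero _).hasFDerivAt.comp_hasDerivAt t (hasDerivAt_line x z t)

theorem hasDerivAt_fderiv_comp_line (hu : ContDiff ℝ 2 u) (x z : E) (t : ℝ) :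
    HasDerivAt (fun r : ℝ => fderiv ℝ u (x + r • z) z)
      (fderiv ℝ (fderiv ℝ u) (x + t • z) z z) t := by
  have hu' : ContDiff ℝ 1 (fderiv ℝ u) := hu.fderiv_right (by norm_num)
  have h := (hu'.differentiable one_ne_zero _).hasFDerivAt.comp_hasDerivAt t (hasDerivAt_line x z t)
  simpa using h.clm_apply (hasDerivAt_const t z)

theorem exists_abs_secondDiff_le_of_contDiff [ProperSpace E] (hu : ContDiff ℝ 2 u) (R : ℝ) :
    ∃ B, 0 ≤ B ∧ ∀ x z : E, ‖x‖ ≤ R → ‖z‖ ≤ 1 → |secondDiff u x z| ≤ B * ‖z‖ ^ 2 := by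
  have hu' : ContDiff ℝ 1 (fderiv ℝ u) := hu.fderiv_right (by norm_num)
  have hu'' : Continuous (fderiv ℝ (fderiv ℝ u)) := hu'.continuous_fderiv one_ne_zero
  obtain ⟨B, hB⟩ := IsCompact.exists_bound_of_continuousOn (f := fderiv ℝ (fderiv ℝ u))
    (isCompact_closedBall (0 : E) (R + 1)) hu''.continuousOn
  refine ⟨2 * max B 0, by positivity, fun x z hx hz => ?_⟩
  refine (abs_secondDiff_le_of_line (B := max B 0 * ‖z‖ * ‖z‖)
    (fun t _ => hasDerivAt_comp_line hu x z t)
    (fun t _ => hasDerivAt_fderiv_comp_line hu x z t) fun t ht => ?_).trans_eq (by ring)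
  have hmem : x + t • z ∈ closedBall (0 : E) (R + 1) := by
    rw [mem_closedBall_zero_iff]
    refine (norm_add_le _ _).trans (add_le_add hx ?_)
    rw [norm_smul]
    exact mul_le_one₀ ht (norm_nonneg _) hz
  calc |fderiv ℝ (fderiv ℝ u) (x + t • z) z z|
      ≤ ‖fderiv ℝ (fderiv ℝ u) (x + t • z)‖ * ‖z‖ * ‖z‖ := by
        rw [← Real.norm_eq_abs]
        exact ContinuousLinearMap.le_opNorm₂ _ z z
    _ ≤ max B 0 * ‖z‖ * ‖z‖ := by gcongr; exact (hB _ hmem).trans (le_max_left _ _)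

end

/-- The discrete Laplacian with step `h` along the orthonormal basis `b`. -/
noncomputable def discreteLaplacian [InnerProductSpace ℝ E] {ι : Type*} [Fintype ι]
    (b : OrthonormalBasis ι ℝ E) (f : E → ℝ) (h : ℝ) (x : E) : ℝ :=
  ∑ i, secondDiff f x (h • b i) / h ^ 2

theorem tendsto_discreteLaplacian [InnerProductSpace ℝ E] [FiniteDimensional ℝ E]
    {ι : Type*} [Fintype ι] (b : OrthonormalBasis ι ℝ E) {u : E → ℝ} (hu : ContDiff ℝ 2 u) (x : E) :
    Tendsto (fun h => discreteLaplacian b u h x) (𝓝[>] 0) (𝓝 (Laplacian.laplacian u x)) := by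
  rw [InnerProductSpace.laplacian_eq_iteratedFDeriv_orthonormalBasis u b]
  refine tendsto_finsetSum _ fun i _ => ?_
  rw [iteratedFDeriv_two_apply]
  have hsecond := hasDerivAt_fderiv_comp_line hu x (b i) 0
  rw [zero_smul, add_zero] at hsecond
  exact tendsto_secondDiff_smul_div_sq (hasDerivAt_comp_line hu x (b i)) hsecond

end ContDiff

end SecondDifference

section Weights

/-- The Japanese bracket `√(1 + ‖x‖²)`. -/
noncomputable def japaneseBracket {E : Type*} [Norm E] (x : E) : ℝ := √(1 + ‖x‖ ^ 2)

section Bracket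

variable {E : Type*} [SeminormedAddCommGroup E]

theorem japaneseBracket_sq (x : E) : japaneseBracket x ^ 2 = 1 + ‖x‖ ^ 2 :=
  Real.sq_sqrt (by positivity)

theorem one_le_japaneseBracket (x : E) : 1 ≤ japaneseBracket x :=
  Real.one_le_sqrt.2 (by nlinarith [sq_nonneg ‖x‖])

theorem japaneseBracket_pos (x : E) : 0 < japaneseBracket x :=
  one_pos.trans_le (one_le_japaneseBracket x)

theorem norm_le_japaneseBracket (x : E) : ‖x‖ ≤ japaneseBracket x :=
  Real.le_sqrt_of_sq_le (by linarith)

theorem japaneseBracket_le_add_norm_sub (x y : E) :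
    japaneseBracket x ≤ japaneseBracket y + ‖x - y‖ := by
  have htriangle : ‖x‖ ≤ ‖y‖ + ‖x - y‖ := by simpa using norm_add_le y (x - y)
  refine Real.sqrt_le_iff.2 ⟨by positivity [japaneseBracket_pos y], ?_⟩
  nlinarith [japaneseBracket_sq y, norm_le_japaneseBracket y, norm_nonneg x, norm_nonneg (x - y)]

theorem half_japaneseBracket_le_add_smul {E : Type*} [SeminormedAddCommGroup E] [NormedSpace ℝ E]
    {x z : E} {t : ℝ} (ht : |t| ≤ 1) (hz : ‖z‖ ≤ japaneseBracket x / 2) :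
    japaneseBracket x / 2 ≤ japaneseBracket (x + t • z) := by
  have h := japaneseBracket_le_add_norm_sub x (x + t • z)
  rw [sub_add_cancel_left, norm_neg, norm_smul, Real.norm_eq_abs] at h
  nlinarith [norm_nonneg z]

theorem continuous_japaneseBracket : Continuous (japaneseBracket : E → ℝ) := by
  unfold japaneseBracket
  fun_prop

end Bracket

section WeightPsi

variable {N : ℕ}

theorem weightPsi_eq_rpow (β : ℝ) (x : ℝ^N) : weightPsi β x = japaneseBracket x ^ (-β) := by
  rw [weightPsi, japaneseBracket, Real.sqrt_eq_rpow, ← Real.rpow_mul (by positivity)]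
  congr 1
  ring

theorem weightPsi_pos (β : ℝ) (x : ℝ^N) : 0 < weightPsi β x := by
  unfold weightPsi
  positivity

theorem weightPsi_add (a b : ℝ) (x : ℝ^N) :
    weightPsi (a + b) x = weightPsi a x * weightPsi b x := by
  simp only [weightPsi_eq_rpow, neg_add, Real.rpow_add (japaneseBracket_pos x)]

theorem weightPsi_antitone (x : ℝ^N) : Antitone fun β => weightPsi β x := fun a b h => by
  simp only [weightPsi_eq_rpow]
  exact Real.rpow_le_rpow_of_exponent_le (one_le_japaneseBracket x) (neg_le_neg h)

theorem continuous_weightPsi (β : ℝ) : Continuous (weightPsi β : ℝ^N → ℝ) := by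
  unfold weightPsi
  exact Continuous.rpow_const (by fun_prop) fun x => Or.inl (by positivity)

end WeightPsi

/-- `F`, with first and second derivatives `F'` and `F''`, is a symbol of order `m` on the half line
`[0, ∞)`: each derivative gains a power of `1 + r`. -/
structure HasSymbolBound (m A : ℝ) (F F' F'' : ℝ → ℝ) : Prop where
  hasDerivAt : ∀ r, 0 ≤ r → HasDerivAt F (F' r) r
  hasDerivAt_deriv : ∀ r, 0 ≤ r → HasDerivAt F' (F'' r) r
  abs_le : ∀ r, 0 ≤ r → |F r| ≤ A * (1 + r) ^ m
  abs_deriv_le : ∀ r, 0 ≤ r → |F' r| ≤ A * (1 + r) ^ (m - 1)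
  abs_deriv2_le : ∀ r, 0 ≤ r → |F'' r| ≤ A * (1 + r) ^ (m - 2)

section SymbolBound

variable {m n A B : ℝ} {F F' F'' G G' G'' : ℝ → ℝ}

theorem abs_mul_le_of_symbol {a b r : ℝ} (hr : 0 ≤ r) (ha : |a| ≤ A * (1 + r) ^ m)
    (hb : |b| ≤ B * (1 + r) ^ n) : |a * b| ≤ A * B * (1 + r) ^ (m + n) := by
  rw [abs_mul, Real.rpow_add (by linarith)]
  calc |a| * |b| ≤ A * (1 + r) ^ m * (B * (1 + r) ^ n) :=
        mul_le_mul ha hb (abs_nonneg b) ((abs_nonneg a).trans ha)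
    _ = A * B * ((1 + r) ^ m * (1 + r) ^ n) := by ring

theorem HasSymbolBound.mul (hF : HasSymbolBound m A F F' F'') (hG : HasSymbolBound n B G G' G'') :
    HasSymbolBound (m + n) (4 * (A * B)) (fun r => F r * G r) (fun r => F' r * G r + F r * G' r)
      (fun r => F'' r * G r + F' r * G' r + (F' r * G' r + F r * G'' r)) where
  hasDerivAt r hr := (hF.hasDerivAt r hr).mul (hG.hasDerivAt r hr)
  hasDerivAt_deriv r hr := ((hF.hasDerivAt_deriv r hr).mul (hG.hasDerivAt r hr)).add
    ((hF.hasDerivAt r hr).mul (hG.hasDerivAt_deriv r hr))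
  abs_le r hr := by
    have h := abs_mul_le_of_symbol hr (hF.abs_le r hr) (hG.abs_le r hr)
    linarith [(abs_nonneg _).trans h]
  abs_deriv_le r hr := by
    have h₁ := abs_mul_le_of_symbol hr (hF.abs_deriv_le r hr) (hG.abs_le r hr)
    have h₂ := abs_mul_le_of_symbol hr (hF.abs_le r hr) (hG.abs_deriv_le r hr)
    rw [show m - 1 + n = m + n - 1 by ring] at h₁
    rw [show m + (n - 1) = m + n - 1 by ring] at h₂
    linarith [abs_add_le (F' r * G r) (F r * G' r), (abs_nonneg _).trans h₁]
  abs_deriv2_le r hr := by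
    have h₁ := abs_mul_le_of_symbol hr (hF.abs_deriv2_le r hr) (hG.abs_le r hr)
    have h₂ := abs_mul_le_of_symbol hr (hF.abs_deriv_le r hr) (hG.abs_deriv_le r hr)
    have h₃ := abs_mul_le_of_symbol hr (hF.abs_le r hr) (hG.abs_deriv2_le r hr)
    rw [show m - 2 + n = m + n - 2 by ring] at h₁
    rw [show m - 1 + (n - 1) = m + n - 2 by ring] at h₂
    rw [show m + (n - 2) = m + n - 2 by ring] at h₃
    linarith [abs_add_le (F'' r * G r + F' r * G' r) (F' r * G' r + F r * G'' r),
      abs_add_le (F'' r * G r) (F' r * G' r), abs_add_le (F' r * G' r) (F r * G'' r)]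

theorem hasSymbolBound_rpow (m : ℝ) :
    HasSymbolBound m (1 + |m| + |m * (m - 1)|) (fun r => (1 + r) ^ m)
      (fun r => m * (1 + r) ^ (m - 1)) (fun r => m * ((m - 1) * (1 + r) ^ (m - 2))) := by
  have hderiv : ∀ e r : ℝ, 0 ≤ r →
      HasDerivAt (fun r : ℝ => (1 + r) ^ e) (e * (1 + r) ^ (e - 1)) r := fun e r hr => by
    simpa using ((hasDerivAt_id r).const_add 1).rpow_const (p := e) (Or.inl (by positivity))
  have hpos : ∀ e r : ℝ, 0 ≤ r → 0 < (1 + r) ^ e := fun e r hr => by positivity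
  have h₁ := abs_nonneg m
  have h₂ := abs_nonneg (m * (m - 1))
  refine ⟨hderiv m, fun r hr => ?_, fun r hr => ?_, fun r hr => ?_, fun r hr => ?_⟩
  · have h := (hderiv (m - 1) r hr).const_mul m
    rwa [show m - 1 - 1 = m - 2 by ring] at h
  · rw [abs_of_pos (hpos m r hr)]
    exact le_mul_of_one_le_left (hpos m r hr).le (by linarith)
  · rw [abs_mul, abs_of_pos (hpos _ r hr)]
    exact mul_le_mul_of_nonneg_right (by linarith) (hpos _ r hr).le
  · rw [← mul_assoc, abs_mul, abs_of_pos (hpos _ r hr)]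
    exact mul_le_mul_of_nonneg_right (by linarith) (hpos _ r hr).le

theorem hasDerivAt_max_zero_pow (k : ℕ) (x : ℝ) :
    HasDerivAt (fun x : ℝ => max 0 x ^ (k + 2)) ((k + 2 : ℝ) * max 0 x ^ (k + 1)) x := by
  rcases lt_trichotomy x 0 with hx | rfl | hx
  · have hzero : (fun x : ℝ => max 0 x ^ (k + 2)) =ᶠ[𝓝 x] fun _ => 0 := by
      filter_upwards [Iio_mem_nhds hx] with y (hy : y < 0)
      simp [max_eq_left hy.le]
    simpa [max_eq_left hx.le] using (hasDerivAt_const x (0 : ℝ)).congr_of_eventuallyEq hzero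
  · rw [hasDerivAt_iff_isLittleO]
    have hbound : (fun y : ℝ => max 0 y ^ (k + 2)) =O[𝓝 0] fun y => y ^ (k + 2) := by
      refine .of_bound 1 (.of_forall fun y => ?_)
      rw [norm_pow, norm_pow, one_mul, Real.norm_eq_abs, Real.norm_eq_abs,
        abs_of_nonneg (le_max_left 0 y)]
      gcongr
      exact max_le (abs_nonneg y) (le_abs_self y)
    have hsmall : (fun y : ℝ => y ^ (k + 2)) =o[𝓝 0] fun y => y := by
      simpa using Asymptotics.isLittleO_pow_pow (𝕜 := ℝ) (m := 1) (n := k + 2) (by omega)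
    simpa using hbound.trans_isLittleO hsmall
  · have hpow : (fun x : ℝ => max 0 x ^ (k + 2)) =ᶠ[𝓝 x] fun y => y ^ (k + 2) := by
      filter_upwards [Ioi_mem_nhds hx] with y hy
      rw [max_eq_right (le_of_lt hy)]
    simpa [max_eq_right hx.le] using (hasDerivAt_pow (k + 2) x).congr_of_eventuallyEq hpow

theorem max_zero_one_sub_div_le {R r : ℝ} (hR : 1 ≤ R) (hr : 0 ≤ r) (k : ℕ) :
    max 0 (1 - r / R) / R ^ k ≤ 2 ^ k * (1 + r) ^ (-k : ℝ) := by
  have hR₀ : 0 < R := by linarith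
  rw [Real.rpow_neg (by positivity), Real.rpow_natCast, ← div_eq_mul_inv, ← div_pow]
  rcases le_total (1 - r / R) 0 with h | h
  · rw [max_eq_left h, zero_div]
    positivity
  · have hrR : r ≤ R := (div_le_one hR₀).1 (by linarith)
    have hinv : 1 / R ≤ 2 / (1 + r) := by
      rw [div_le_div_iff₀ hR₀ (by positivity)]
      linarith
    calc max 0 (1 - r / R) / R ^ k ≤ 1 / R ^ k := by
          gcongr
          exact max_le zero_le_one (by linarith [div_nonneg hr hR₀.le])
      _ = (1 / R) ^ k := by rw [div_pow, one_pow]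
      _ ≤ (2 / (1 + r)) ^ k := by gcongr

theorem hasSymbolBound_max_zero_one_sub_div {R : ℝ} (hR : 1 ≤ R) :
    HasSymbolBound 0 24 (fun r => max 0 (1 - r / R) ^ 3)
      (fun r => -(3 * max 0 (1 - r / R) ^ 2 / R)) (fun r => 6 * max 0 (1 - r / R) / R ^ 2) := by
  have hR₀ : 0 < R := by linarith
  have hinner : ∀ r, HasDerivAt (fun r : ℝ => 1 - r / R) (-(1 / R)) r := fun r =>
    ((hasDerivAt_id r).div_const R).const_sub 1
  have hnonneg : ∀ r, 0 ≤ max 0 (1 - r / R) := fun r => le_max_left _ _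
  have hle : ∀ r, 0 ≤ r → max 0 (1 - r / R) ≤ 1 := fun r hr =>
    max_le zero_le_one (by linarith [div_nonneg hr hR₀.le])
  refine ⟨fun r _ => ?_, fun r _ => ?_, fun r hr => ?_, fun r hr => ?_, fun r hr => ?_⟩
  · refine ((hasDerivAt_max_zero_pow 1 (1 - r / R)).comp r (hinner r)).congr_deriv ?_
    push_cast
    ring
  · refine ((((hasDerivAt_max_zero_pow 0 (1 - r / R)).comp r (hinner r)).const_mul 3).div_const R
      |>.neg).congr_deriv ?_
    push_cast
    field_simp
    ring
  · rw [abs_of_nonneg (pow_nonneg (hnonneg r) 3), Real.rpow_zero]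
    linarith [pow_le_one₀ (n := 3) (hnonneg r) (hle r hr)]
  · have h := max_zero_one_sub_div_le hR hr 1
    have hsq : max 0 (1 - r / R) ^ 2 ≤ max 0 (1 - r / R) :=
      pow_le_of_le_one (hnonneg r) (hle r hr) two_ne_zero
    have hdiv : max 0 (1 - r / R) ^ 2 / R ≤ max 0 (1 - r / R) / R := by gcongr
    rw [abs_neg, abs_of_nonneg (by positivity), zero_sub, mul_div_assoc]
    norm_num at h
    have : 0 < (1 + r) ^ (-1 : ℝ) := by positivity
    linarith
  · have h := max_zero_one_sub_div_le hR hr 2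
    have := hnonneg r
    rw [abs_of_nonneg (by positivity), zero_sub, mul_div_assoc]
    norm_num at h ⊢
    linarith

end SymbolBound

theorem HasSymbolBound.abs_deriv2_mul_add_le (hF : HasSymbolBound m A F F' F'') {r a b : ℝ}
    (hr : 0 ≤ r) (hb : 0 ≤ b) (hab : |a| ^ 2 ≤ 4 * (1 + r) * b) :
    |F'' r * a * a + F' r * (2 * b)| ≤ 6 * A * (1 + r) ^ (m - 1) * b := by
  have hA : 0 ≤ A := by simpa using (abs_nonneg _).trans (hF.abs_le 0 le_rfl)
  have hpow : (1 + r) ^ (m - 2) * (1 + r) = (1 + r) ^ (m - 1) := by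
    rw [← Real.rpow_add_one (by positivity)]
    congr 1
    ring
  calc |F'' r * a * a + F' r * (2 * b)|
      ≤ |F'' r| * |a| ^ 2 + |F' r| * (2 * b) := by
        refine (abs_add_le _ _).trans_eq ?_
        rw [mul_assoc, abs_mul, abs_mul (F' r), abs_mul a, ← sq,
          abs_of_nonneg (mul_nonneg two_pos.le hb)]
    _ ≤ A * (1 + r) ^ (m - 2) * (4 * (1 + r) * b) + A * (1 + r) ^ (m - 1) * (2 * b) := by
        gcongr
        · exact hF.abs_deriv2_le _ hr
        · exact hF.abs_deriv_le _ hr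
    _ = 6 * A * (1 + r) ^ (m - 1) * b := by rw [← hpow]; ring

theorem abs_secondDiff_radial_le {E : Type*} [NormedAddCommGroup E] [InnerProductSpace ℝ E]
    {m A : ℝ} {F F' F'' : ℝ → ℝ} (hF : HasSymbolBound m A F F' F'') (hm : m ≤ 1) {x z : E}
    (hz : ‖z‖ ≤ japaneseBracket x / 2) :
    |secondDiff (fun y => F (‖y‖ ^ 2)) x z| ≤
      12 * A * (japaneseBracket x / 2) ^ (2 * (m - 1)) * ‖z‖ ^ 2 := by
  set q : ℝ → ℝ := fun t => ‖x + t • z‖ ^ 2 with hq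
  set q' : ℝ → ℝ := fun t => 2 * inner ℝ (x + t • z) z with hq'
  have hq₀ : ∀ t, 0 ≤ q t := fun t => by positivity
  have hdq : ∀ t, HasDerivAt q (q' t) t := fun t => (hasDerivAt_line x z t).norm_sq
  have hdq' : ∀ t, HasDerivAt q' (2 * ‖z‖ ^ 2) t := fun t => by
    refine (((hasDerivAt_line x z t).inner ℝ (hasDerivAt_const t z)).const_mul 2).congr_deriv ?_
    simp
  have hA : 0 ≤ A := by simpa using (abs_nonneg _).trans (hF.abs_le 0 le_rfl)
  refine (abs_secondDiff_le_of_line (B := 6 * A * (japaneseBracket x / 2) ^ (2 * (m - 1)) * ‖z‖ ^ 2)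
    (g'' := fun t => F'' (q t) * q' t * q' t + F' (q t) * (2 * ‖z‖ ^ 2))
    (fun t _ => (hF.hasDerivAt _ (hq₀ t)).comp t (hdq t))
    (fun t _ => ((hF.hasDerivAt_deriv _ (hq₀ t)).comp t (hdq t)).mul (hdq' t))
    fun t ht => ?_).trans_eq (by ring)
  have hq'_sq : |q' t| ^ 2 ≤ 4 * (1 + q t) * ‖z‖ ^ 2 := by
    have hinner := abs_real_inner_le_norm (x + t • z) z
    calc |q' t| ^ 2 = 4 * |inner ℝ (x + t • z) z| ^ 2 := by rw [hq', abs_mul, abs_two]; ring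
      _ ≤ 4 * (‖x + t • z‖ * ‖z‖) ^ 2 := by gcongr
      _ = 4 * q t * ‖z‖ ^ 2 := by rw [hq]; ring
      _ ≤ 4 * (1 + q t) * ‖z‖ ^ 2 := by gcongr; linarith
  have hcompare : (1 + q t) ^ (m - 1) ≤ (japaneseBracket x / 2) ^ (2 * (m - 1)) := by
    have hbracket := half_japaneseBracket_le_add_smul ht hz
    have hx := half_pos (japaneseBracket_pos x)
    rw [Real.rpow_mul hx.le, Real.rpow_two]
    refine Real.rpow_le_rpow_of_nonpos (by positivity) ?_ (by linarith)
    rw [hq, ← japaneseBracket_sq]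
    gcongr
  refine (hF.abs_deriv2_mul_add_le (hq₀ t) (sq_nonneg _) hq'_sq).trans ?_
  gcongr

/-- The compactly supported approximation `ψ_β(x) (1 - |x|² / R)₊³` of the weight `ψ_β`. The third
power makes it twice differentiable. -/
noncomputable def cutoffWeight {N : ℕ} (β R : ℝ) (x : ℝ^N) : ℝ :=
  weightPsi β x * max 0 (1 - ‖x‖ ^ 2 / R) ^ 3

section CutoffWeight

variable {N : ℕ} {β R : ℝ}

theorem cutoffWeight_nonneg (β R : ℝ) (x : ℝ^N) : 0 ≤ cutoffWeight β R x :=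
  mul_nonneg (weightPsi_pos β x).le (by positivity)

theorem cutoffWeight_le_weightPsi (β : ℝ) (hR : 0 ≤ R) (x : ℝ^N) :
    cutoffWeight β R x ≤ weightPsi β x :=
  mul_le_of_le_one_right (weightPsi_pos β x).le <| pow_le_one₀ (le_max_left _ _) <|
    max_le zero_le_one (sub_le_self _ (by positivity))

theorem continuous_cutoffWeight (β R : ℝ) : Continuous (cutoffWeight β R : ℝ^N → ℝ) :=
  (continuous_weightPsi β).mul (by fun_prop)

theorem hasCompactSupport_cutoffWeight (β : ℝ) (hR : 0 < R) :
    HasCompactSupport (cutoffWeight β R : ℝ^N → ℝ) := by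
  refine HasCompactSupport.intro (isCompact_closedBall 0 √R) fun x hx => ?_
  rw [mem_closedBall_zero_iff, not_le] at hx
  have hle : 1 - ‖x‖ ^ 2 / R ≤ 0 := by
    rw [sub_nonpos, one_le_div hR]
    exact (Real.lt_sq_of_sqrt_lt hx).le
  simp [cutoffWeight, max_eq_left hle]

theorem tendsto_cutoffWeight (β : ℝ) (x : ℝ^N) :
    Tendsto (fun R => cutoffWeight β R x) atTop (𝓝 (weightPsi β x)) := by
  have hlim : Tendsto (fun R => 1 - ‖x‖ ^ 2 / R) atTop (𝓝 (1 - 0)) :=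
    (tendsto_id.const_div_atTop _).const_sub 1
  have hmax := (tendsto_const_nhds (x := (0 : ℝ))).max hlim
  simpa [cutoffWeight] using (hmax.pow 3).const_mul (weightPsi β x)

theorem exists_abs_secondDiff_cutoffWeight_le (N : ℕ) (hβ : -2 ≤ β) :
    ∃ A, 0 ≤ A ∧ ∀ R, 1 ≤ R → ∀ x z : ℝ^N, ‖z‖ ≤ japaneseBracket x / 2 →
      |secondDiff (cutoffWeight β R) x z| ≤ A * weightPsi (β + 2) x * ‖z‖ ^ 2 := by
  refine ⟨12 * (4 * ((1 + |-β / 2| + |-β / 2 * (-β / 2 - 1)|) * 24)) * 2 ^ (β + 2), by positivity,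
    fun R hR x z hz => ?_⟩
  refine (abs_secondDiff_radial_le
    ((hasSymbolBound_rpow (-β / 2)).mul (hasSymbolBound_max_zero_one_sub_div hR))
    (by linarith) hz).trans_eq ?_
  rw [weightPsi_eq_rpow, Real.div_rpow (japaneseBracket_pos x).le two_pos.le,
    show 2 * (-β / 2 + 0 - 1) = -(β + 2) by ring, Real.rpow_neg two_pos.le, div_inv_eq_mul]
  ring

theorem abs_secondDiff_cutoffWeight_le (β : ℝ) (hR : 0 ≤ R) (x z : ℝ^N) :
    |secondDiff (cutoffWeight β R) x z| ≤
      weightPsi β (x + z) + weightPsi β (x - z) + 2 * weightPsi β x := by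
  have h : ∀ y : ℝ^N, 0 ≤ cutoffWeight β R y ∧ cutoffWeight β R y ≤ weightPsi β y := fun y =>
    ⟨cutoffWeight_nonneg β R y, cutoffWeight_le_weightPsi β hR y⟩
  have hx := h x
  have hp := h (x + z)
  have hm := h (x - z)
  rw [secondDiff, abs_le]
  constructor <;> linarith

end CutoffWeight

end Weights

section RadialKernel

/-- The radial kernel `‖z‖^(-b) max(r, ‖z‖)^(-e)`, which behaves like `‖z‖^(-b)` near the origin and
like `‖z‖^(-b-e)` at infinity. -/
noncomputable def radialKernel {E : Type*} [Norm E] (b e r : ℝ) (z : E) : ℝ :=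
  ‖z‖ ^ (-b) * max r ‖z‖ ^ (-e)

variable {E : Type*} [NormedAddCommGroup E] {b e r : ℝ}

theorem radialKernel_nonneg (b e r : ℝ) (z : E) : 0 ≤ radialKernel b e r z :=
  mul_nonneg (by positivity)
    (Real.rpow_nonneg (le_max_of_le_right (norm_nonneg z)) _)

variable [NormedSpace ℝ E] [FiniteDimensional ℝ E] [MeasurableSpace E] [BorelSpace E]
  (μ : Measure E) [μ.IsAddHaarMeasure]

theorem integrable_radialKernel [Nontrivial E] (hb : b < Module.finrank ℝ E)
    (he : Module.finrank ℝ E < b + e) (hr : 0 < r) : Integrable (radialKernel b e r : E → ℝ) μ := by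
  set d := Module.finrank ℝ E with hd
  have hd₀ : 1 ≤ d := Module.finrank_pos
  refine (integrable_fun_norm_addHaar μ (f := fun t => t ^ (-b) * max r t ^ (-e))).2 ?_
  rw [← hd]
  have hpow : ∀ t : ℝ, 0 < t → t ^ (d - 1) * t ^ (-b) = t ^ ((d : ℝ) - 1 - b) := fun t ht => by
    rw [sub_eq_add_neg _ b, Real.rpow_add ht, ← Real.rpow_natCast, Nat.cast_sub hd₀, Nat.cast_one]
  rw [← Ioc_union_Ioi_eq_Ioi hr.le]
  refine IntegrableOn.union ?_ ?_
  · have h := (intervalIntegral.intervalIntegrable_rpow' (a := 0) (b := r)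
      (r := (d : ℝ) - 1 - b) (by linarith)).1.mul_const (r ^ (-e))
    refine IntegrableOn.congr_fun h (fun t ht => ?_) measurableSet_Ioc
    simp only [smul_eq_mul, max_eq_left ht.2, ← hpow t ht.1, mul_assoc]
  · have h := integrableOn_Ioi_rpow_of_lt (a := (d : ℝ) - 1 - b - e) (by linarith) hr
    refine h.congr_fun (fun t (ht : r < t) => ?_) measurableSet_Ioi
    have ht₀ := hr.trans ht
    simp only [smul_eq_mul, max_eq_right ht.le, sub_eq_add_neg _ e, Real.rpow_add ht₀,
      ← hpow t ht₀, mul_assoc]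

theorem integral_radialKernel (b e : ℝ) (hr : 0 < r) :
    ∫ z, radialKernel b e r z ∂μ =
      r ^ (Module.finrank ℝ E - b - e) * ∫ z, radialKernel b e 1 z ∂μ := by
  have hscale : ∀ z : E, radialKernel b e r (r • z) = r ^ (-b - e) * radialKernel b e 1 z := by
    intro z
    have hmax : max r (r * ‖z‖) = r * max 1 ‖z‖ := by rw [mul_max_of_nonneg _ _ hr.le, mul_one]
    simp only [radialKernel]
    rw [norm_smul, Real.norm_of_nonneg hr.le, hmax, Real.mul_rpow hr.le (norm_nonneg z),
      Real.mul_rpow hr.le (by positivity), sub_eq_add_neg, Real.rpow_add hr]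
    ring
  have h := Measure.integral_comp_smul_of_nonneg μ (radialKernel b e r : E → ℝ) r (hR := hr.le)
  simp only [hscale, integral_const_mul, smul_eq_mul] at h
  rw [inv_mul_eq_div, eq_div_iff (by positivity)] at h
  rw [← h, show (Module.finrank ℝ E : ℝ) - b - e = -b - e + Module.finrank ℝ E by ring,
    Real.rpow_add hr, Real.rpow_natCast]
  ring

end RadialKernel

section TailDecay

variable {N : ℕ} {s β σ τ : ℝ}

/-- The kernel `ψ_β(y) max(⟨x⟩, ⟨y⟩)^(-N-2s)`, which controls the contribution to `(-Δ)^s ψ_β (x)`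
of the points `y` at distance at least `⟨x⟩ / 2` from `x`. -/
noncomputable def tailKernel (s β : ℝ) (x y : ℝ^N) : ℝ :=
  weightPsi β y * max (japaneseBracket x) (japaneseBracket y) ^ (-((N : ℝ) + 2 * s))

/-- The long range part of `(-Δ)^s ψ_β` decays at least as fast as `ψ_σ`. -/
def HasTailDecay (N : ℕ) (s β σ : ℝ) : Prop :=
  ∃ C, ∀ x : ℝ^N, Integrable (tailKernel s β x) ∧ ∫ y, tailKernel s β x y ≤ C * weightPsi σ x

theorem max_japaneseBracket_pos (x y : ℝ^N) : 0 < max (japaneseBracket x) (japaneseBracket y) :=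
  lt_max_of_lt_left (japaneseBracket_pos x)

theorem tailKernel_nonneg (s β : ℝ) (x y : ℝ^N) : 0 ≤ tailKernel s β x y :=
  mul_nonneg (weightPsi_pos β y).le (Real.rpow_nonneg (max_japaneseBracket_pos x y).le _)

theorem continuous_tailKernel (s β : ℝ) (x : ℝ^N) : Continuous (tailKernel s β x) :=
  (continuous_weightPsi β).mul <| (continuous_const.max continuous_japaneseBracket).rpow_const
    fun y => Or.inl (max_japaneseBracket_pos x y).ne'

theorem HasTailDecay.mono (h : HasTailDecay N s β σ) (hτ : τ ≤ σ) : HasTailDecay N s β τ := by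
  obtain ⟨C, hC⟩ := h
  have hC₀ : 0 ≤ C := nonneg_of_mul_nonneg_left
    ((integral_nonneg (tailKernel_nonneg s β 0)).trans (hC 0).2) (weightPsi_pos σ 0)
  exact ⟨C, fun x => ⟨(hC x).1, (hC x).2.trans
    (mul_le_mul_of_nonneg_left (weightPsi_antitone x hτ) hC₀)⟩⟩

theorem hasTailDecay_of_le (hσ₀ : 0 ≤ σ) (hσ : σ ≤ N + 2 * s) (hσβ : σ < β + 2 * s) :
    HasTailDecay N s β σ := by
  set a := β + (N + 2 * s - σ) with ha
  have hint : Integrable (weightPsi a : ℝ^N → ℝ) :=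
    integrable_rpow_neg_one_add_norm_sq (by rw [finrank_euclideanSpace_fin]; linarith)
  have hbound : ∀ x y : ℝ^N, tailKernel s β x y ≤ weightPsi σ x * weightPsi a y := by
    intro x y
    have hx : max (japaneseBracket x) (japaneseBracket y) ^ (-σ) ≤ weightPsi σ x := by
      rw [weightPsi_eq_rpow]
      exact Real.rpow_le_rpow_of_nonpos (japaneseBracket_pos x) (le_max_left _ _) (by linarith)
    have hy : max (japaneseBracket x) (japaneseBracket y) ^ (-(N + 2 * s - σ)) ≤
        weightPsi (N + 2 * s - σ) y := by
      rw [weightPsi_eq_rpow]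
      exact Real.rpow_le_rpow_of_nonpos (japaneseBracket_pos y) (le_max_right _ _) (by linarith)
    have hM := max_japaneseBracket_pos x y
    rw [tailKernel, show -((N : ℝ) + 2 * s) = -σ + -(N + 2 * s - σ) by ring, Real.rpow_add hM, ha,
      weightPsi_add]
    calc weightPsi β y * (max (japaneseBracket x) (japaneseBracket y) ^ (-σ) *
          max (japaneseBracket x) (japaneseBracket y) ^ (-(N + 2 * s - σ)))
        ≤ weightPsi β y * (weightPsi σ x * weightPsi (N + 2 * s - σ) y) := by
          have := (weightPsi_pos β y).le
          have := (weightPsi_pos σ x).le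
          gcongr
      _ = _ := by ring
  refine ⟨∫ y : ℝ^N, weightPsi a y, fun x => ?_⟩
  have hint' := hint.const_mul (weightPsi σ x)
  have htail : Integrable (tailKernel s β x) :=
    hint'.mono' (continuous_tailKernel s β x).aestronglyMeasurable <| .of_forall fun y => by
      rw [Real.norm_of_nonneg (tailKernel_nonneg s β x y)]
      exact hbound x y
  refine ⟨htail, (integral_mono htail hint' (hbound x)).trans_eq ?_⟩
  rw [integral_const_mul, mul_comm]

theorem tailKernel_le_radialKernel (hβ : -2 * s - N ≤ β) (hs : 0 ≤ s) (x : ℝ^N) {y : ℝ^N}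
    (hy : y ≠ 0) :
    tailKernel s β x y ≤
      radialKernel (max β 0) (N + 2 * s - max (-β) 0) (japaneseBracket x) y := by
  set M := max (japaneseBracket x) (japaneseBracket y)
  have hM : 0 < M := max_japaneseBracket_pos x y
  have hsplit : weightPsi β y =
      japaneseBracket y ^ (-max β 0) * japaneseBracket y ^ max (-β) 0 := by
    rw [weightPsi_eq_rpow, ← Real.rpow_add (japaneseBracket_pos y)]
    congr 1
    rcases le_total β 0 with h | h <;> simp [h]
  have hdecay : japaneseBracket y ^ (-max β 0) ≤ ‖y‖ ^ (-max β 0) :=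
    Real.rpow_le_rpow_of_nonpos (norm_pos_iff.2 hy) (norm_le_japaneseBracket y) (by simp)
  have hgrowth : japaneseBracket y ^ max (-β) 0 ≤ M ^ max (-β) 0 :=
    Real.rpow_le_rpow (japaneseBracket_pos y).le (le_max_right _ _) (le_max_right _ _)
  calc tailKernel s β x y
      ≤ ‖y‖ ^ (-max β 0) * M ^ max (-β) 0 * M ^ (-(N + 2 * s)) := by
        have := japaneseBracket_pos y
        rw [tailKernel, hsplit]
        gcongr
    _ = ‖y‖ ^ (-max β 0) * M ^ (-(N + 2 * s - max (-β) 0)) := by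
        rw [mul_assoc, ← Real.rpow_add hM]
        congr 2
        ring
    _ ≤ radialKernel (max β 0) (N + 2 * s - max (-β) 0) (japaneseBracket x) y := by
        have hexp : max (-β) 0 ≤ N + 2 * s := max_le (by linarith) (by positivity)
        refine mul_le_mul_of_nonneg_left (Real.rpow_le_rpow_of_nonpos
          (lt_max_of_lt_left (japaneseBracket_pos x)) ?_ (by linarith)) (by positivity)
        exact max_le_max le_rfl (norm_le_japaneseBracket y)

theorem nontrivial_euclideanSpace (hN : 1 ≤ N) : Nontrivial ℝ^N :=
  Module.nontrivial_of_finrank_pos (R := ℝ) (by rw [finrank_euclideanSpace_fin]; exact hN)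

theorem hasTailDecay_add (hN : 1 ≤ N) (hs : 0 < s) (hβ : -2 * s < β) (hβN : β < N) :
    HasTailDecay N s β (β + 2 * s) := by
  have := nontrivial_euclideanSpace hN
  have hN' : (1 : ℝ) ≤ N := by exact_mod_cast hN
  have hexp : max β 0 - max (-β) 0 = β := by rcases le_total β 0 with h | h <;> simp [h]
  refine ⟨∫ y : ℝ^N, radialKernel (max β 0) (N + 2 * s - max (-β) 0) 1 y, fun x => ?_⟩
  have hint : Integrable
      (radialKernel (max β 0) (N + 2 * s - max (-β) 0) (japaneseBracket x) : ℝ^N → ℝ) := by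
    refine integrable_radialKernel volume ?_ ?_ (japaneseBracket_pos x) <;>
      rw [finrank_euclideanSpace_fin]
    · exact max_lt hβN (by linarith)
    · linarith
  have hbound : ∀ᵐ y : ℝ^N, tailKernel s β x y ≤
      radialKernel (max β 0) (N + 2 * s - max (-β) 0) (japaneseBracket x) y := by
    filter_upwards [compl_mem_ae_iff.2 (measure_singleton (0 : ℝ^N))] with y hy
    exact tailKernel_le_radialKernel (by linarith) hs.le x hy
  have htail : Integrable (tailKernel s β x) :=
    hint.mono' (continuous_tailKernel s β x).aestronglyMeasurable <| hbound.mono fun y hy => by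
      rwa [Real.norm_of_nonneg (tailKernel_nonneg s β x y)]
  refine ⟨htail, (integral_mono_ae htail hint hbound).trans_eq ?_⟩
  rw [integral_radialKernel volume _ _ (japaneseBracket_pos x), mul_comm, weightPsi_eq_rpow,
    finrank_euclideanSpace_fin]
  congr 2
  linarith

end TailDecay

section Majorant

variable {N : ℕ} {s β σ : ℝ}

/-- A majorant, up to a constant factor, of `z ↦ |secondDiff f x z| / |z|^(N+2s)` for `f = ψ_β` and
for all its cutoffs. -/
noncomputable def weightMajorant (s β : ℝ) (x z : ℝ^N) : ℝ :=
  weightPsi β x * radialKernel (N + 2 * s - 2) 2 (japaneseBracket x) z +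
    tailKernel s β x (x + z) + tailKernel s β x (x - z)

theorem weightMajorant_nonneg (s β : ℝ) (x z : ℝ^N) : 0 ≤ weightMajorant s β x z :=
  add_nonneg (add_nonneg (mul_nonneg (weightPsi_pos β x).le (radialKernel_nonneg _ _ _ _))
    (tailKernel_nonneg s β x _)) (tailKernel_nonneg s β x _)

theorem weightPsi_mul_norm_rpow_le_tailKernel (β : ℝ) (hs : 0 ≤ s) {x y : ℝ^N}
    (h : japaneseBracket x / 2 ≤ ‖x - y‖) :
    weightPsi β y * ‖x - y‖ ^ (-((N : ℝ) + 2 * s)) ≤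
      5 ^ ((N : ℝ) + 2 * s) * tailKernel s β x y := by
  have hM := max_japaneseBracket_pos x y
  have hbracket : max (japaneseBracket x) (japaneseBracket y) / 5 ≤ ‖x - y‖ := by
    have hy := japaneseBracket_le_add_norm_sub y x
    rw [norm_sub_rev] at hy
    rw [div_le_iff₀ (by norm_num)]
    exact max_le (by linarith [norm_nonneg (x - y)]) (by linarith [norm_nonneg (x - y)])
  have hpow : ‖x - y‖ ^ (-((N : ℝ) + 2 * s)) ≤ 5 ^ ((N : ℝ) + 2 * s) *
      max (japaneseBracket x) (japaneseBracket y) ^ (-((N : ℝ) + 2 * s)) := by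
    refine (Real.rpow_le_rpow_of_nonpos (by positivity) hbracket
      (neg_nonpos.2 (by positivity))).trans_eq ?_
    rw [Real.div_rpow hM.le (by norm_num), Real.rpow_neg (by norm_num : (0 : ℝ) ≤ 5),
      div_inv_eq_mul, mul_comm]
  rw [tailKernel, mul_left_comm]
  exact mul_le_mul_of_nonneg_left hpow (weightPsi_pos β y).le

theorem norm_rpow_le_radialKernel {q r : ℝ} {z : ℝ^N} (hz₀ : z ≠ 0) (hr : 0 < r)
    (hz : r / 2 ≤ ‖z‖) : ‖z‖ ^ (-q) ≤ 4 * radialKernel (q - 2) 2 r z := by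
  have hz' := norm_pos_iff.2 hz₀
  have hmax : (max r ‖z‖) ^ 2 ≤ 4 * ‖z‖ ^ 2 := by
    have : max r ‖z‖ ≤ 2 * ‖z‖ := max_le (by linarith) (by linarith)
    calc (max r ‖z‖) ^ 2 ≤ (2 * ‖z‖) ^ 2 := by gcongr
      _ = 4 * ‖z‖ ^ 2 := by ring
  have hM : 0 < (max r ‖z‖) ^ 2 := by positivity
  rw [radialKernel, show -(q - 2) = -q + 2 by ring, Real.rpow_add hz', Real.rpow_two,
    Real.rpow_neg (by positivity) 2, Real.rpow_two, ← div_eq_mul_inv, mul_div_assoc',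
    le_div_iff₀ hM]
  have := Real.rpow_pos_of_pos hz' (-q)
  nlinarith

theorem weightPsi_mul_sq_mul_norm_rpow (β : ℝ) {x z : ℝ^N} (hz₀ : z ≠ 0)
    (hz : ‖z‖ ≤ japaneseBracket x) :
    weightPsi (β + 2) x * ‖z‖ ^ 2 * ‖z‖ ^ (-((N : ℝ) + 2 * s)) =
      weightPsi β x * radialKernel (N + 2 * s - 2) 2 (japaneseBracket x) z := by
  rw [radialKernel, max_eq_left hz, weightPsi_add, weightPsi_eq_rpow 2, mul_assoc,
    ← Real.rpow_two, ← Real.rpow_add (norm_pos_iff.2 hz₀),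
    show (2 : ℝ) + -(N + 2 * s) = -(N + 2 * s - 2) by ring]
  ring

theorem add_mul_norm_rpow_le_weightMajorant (hs : 0 ≤ s) {x z : ℝ^N} (hz₀ : z ≠ 0)
    (hz : japaneseBracket x / 2 ≤ ‖z‖) :
    (weightPsi β (x + z) + weightPsi β (x - z) + 2 * weightPsi β x) *
        ‖z‖ ^ (-((N : ℝ) + 2 * s)) ≤
      (8 + 5 ^ ((N : ℝ) + 2 * s)) * weightMajorant s β x z := by
  have hplus := weightPsi_mul_norm_rpow_le_tailKernel β hs (x := x) (y := x + z)
    (by rwa [sub_add_cancel_left, norm_neg])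
  have hminus := weightPsi_mul_norm_rpow_le_tailKernel β hs (x := x) (y := x - z)
    (by rwa [sub_sub_cancel])
  have hcenter := mul_le_mul_of_nonneg_left
    (norm_rpow_le_radialKernel (q := N + 2 * s) hz₀ (japaneseBracket_pos x) hz)
    (weightPsi_pos β x).le
  rw [sub_add_cancel_left, norm_neg] at hplus
  rw [sub_sub_cancel] at hminus
  have hrad := mul_nonneg (weightPsi_pos β x).le
    (radialKernel_nonneg (N + 2 * s - 2) 2 (japaneseBracket x) z)
  have h5 : (0 : ℝ) ≤ 5 ^ ((N : ℝ) + 2 * s) := by positivity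
  unfold weightMajorant
  nlinarith [mul_nonneg h5 hrad, tailKernel_nonneg s β x (x + z), tailKernel_nonneg s β x (x - z)]

theorem exists_abs_secondDiff_cutoffWeight_mul_le (N : ℕ) (hs : 0 ≤ s) (hβ : -2 ≤ β) :
    ∃ D, 0 ≤ D ∧ ∀ R, 1 ≤ R → ∀ x z : ℝ^N,
      |secondDiff (cutoffWeight β R) x z| * ‖z‖ ^ (-((N : ℝ) + 2 * s)) ≤
        D * weightMajorant s β x z := by
  obtain ⟨A, hA₀, hA⟩ := exists_abs_secondDiff_cutoffWeight_le N hβ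
  have hD : (0 : ℝ) ≤ 8 + 5 ^ ((N : ℝ) + 2 * s) := by positivity
  refine ⟨A + (8 + 5 ^ ((N : ℝ) + 2 * s)), add_nonneg hA₀ hD, fun R hR x z => ?_⟩
  have hmajorant := weightMajorant_nonneg s β x z
  rcases eq_or_ne z 0 with rfl | hz₀
  · rw [secondDiff_zero, abs_zero, zero_mul]
    positivity
  rcases le_total ‖z‖ (japaneseBracket x / 2) with hz | hz
  · calc |secondDiff (cutoffWeight β R) x z| * ‖z‖ ^ (-((N : ℝ) + 2 * s))
        ≤ A * weightPsi (β + 2) x * ‖z‖ ^ 2 * ‖z‖ ^ (-((N : ℝ) + 2 * s)) := by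
          gcongr
          exact hA R hR x z hz
      _ = A * (weightPsi β x * radialKernel (N + 2 * s - 2) 2 (japaneseBracket x) z) := by
          rw [← weightPsi_mul_sq_mul_norm_rpow β hz₀
            (hz.trans (half_le_self (japaneseBracket_pos x).le))]
          ring
      _ ≤ (A + (8 + 5 ^ ((N : ℝ) + 2 * s))) * weightMajorant s β x z := by
          refine mul_le_mul (le_add_of_nonneg_right hD) ?_ ?_ (add_nonneg hA₀ hD)
          · unfold weightMajorant
            linarith [tailKernel_nonneg s β x (x + z), tailKernel_nonneg s β x (x - z)]
          · exact mul_nonneg (weightPsi_pos β x).le (radialKernel_nonneg _ _ _ _)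
  · have hfar := abs_secondDiff_cutoffWeight_le β (zero_le_one.trans hR) x z
    grw [hfar, add_mul_norm_rpow_le_weightMajorant hs hz₀ hz]
    exact mul_le_mul_of_nonneg_right (le_add_of_nonneg_left hA₀) hmajorant

theorem exists_integral_weightMajorant_le (hN : 1 ≤ N) (hs₀ : 0 < s) (hs₁ : s < 1)
    (hσ : σ ≤ β + 2 * s) (htail : HasTailDecay N s β σ) :
    ∃ D, 0 ≤ D ∧ ∀ x : ℝ^N, Integrable (weightMajorant s β x) ∧
      ∫ z, weightMajorant s β x z ≤ D * weightPsi σ x := by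
  have := nontrivial_euclideanSpace hN
  obtain ⟨C, hC⟩ := htail
  set c := ∫ z : ℝ^N, radialKernel (N + 2 * s - 2) 2 1 z with hc
  have hc₀ : 0 ≤ c := integral_nonneg (radialKernel_nonneg _ _ _)
  have hC₀ : 0 ≤ C := nonneg_of_mul_nonneg_left
    ((integral_nonneg (tailKernel_nonneg s β 0)).trans (hC 0).2) (weightPsi_pos σ 0)
  refine ⟨c + 2 * C, by positivity, fun x => ?_⟩
  have hrad : Integrable (radialKernel (N + 2 * s - 2) 2 (japaneseBracket x) : ℝ^N → ℝ) := by
    refine integrable_radialKernel volume ?_ ?_ (japaneseBracket_pos x) <;>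
      rw [finrank_euclideanSpace_fin] <;> linarith
  obtain ⟨htail, hle⟩ := hC x
  have hplus := htail.comp_add_left x
  have hminus := htail.comp_sub_left x
  have hrad' := hrad.const_mul (weightPsi β x)
  refine ⟨(hrad'.add hplus).add hminus, ?_⟩
  unfold weightMajorant
  rw [integral_add (by exact hrad'.add hplus) hminus, integral_add hrad' hplus,
    integral_add_left_eq_self (tailKernel s β x), integral_sub_left_eq_self (tailKernel s β x),
    integral_const_mul, integral_radialKernel volume _ _ (japaneseBracket_pos x), ← hc,
    finrank_euclideanSpace_fin, show (N : ℝ) - (N + 2 * s - 2) - 2 = -(2 * s) by ring,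
    ← weightPsi_eq_rpow, ← mul_assoc, ← weightPsi_add]
  nlinarith [weightPsi_antitone x hσ]

end Majorant

section JumpOperator

variable {N : ℕ}

/-- The generator `f ↦ ∫ (f(· + z) + f(· - z) - 2 f) k(z) dz` of the symmetric jumps of intensity
`k`. -/
noncomputable def jumpOperator (k f : ℝ^N → ℝ) (x : ℝ^N) : ℝ :=
  ∫ z, secondDiff f x z * k z

section Kernel

variable {k f : ℝ^N → ℝ} {x : ℝ^N}

theorem integrable_comp_sub_mul (hk : ∀ z, k (-z) = k z)
    (hf : Integrable fun z => f (x + z) * k z) : Integrable fun z => f (x - z) * k z := by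
  simpa only [hk, ← sub_eq_add_neg] using hf.comp_neg

theorem integrable_secondDiff_mul (hk : ∀ z, k (-z) = k z) (hki : Integrable k)
    (hf : Integrable fun z => f (x + z) * k z) : Integrable fun z => secondDiff f x z * k z := by
  refine ((hf.add (integrable_comp_sub_mul hk hf)).sub (hki.const_mul (2 * f x))).congr
    (.of_forall fun z => ?_)
  simp only [secondDiff, Pi.add_apply, Pi.sub_apply]
  ring

theorem integral_comp_sub_mul (hk : ∀ z, k (-z) = k z) (f : ℝ^N → ℝ) (x : ℝ^N) :
    ∫ z, f (x - z) * k z = ∫ z, f (x + z) * k z := by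
  rw [← integral_neg_eq_self]
  simp only [sub_neg_eq_add, hk]

theorem jumpOperator_eq_sub (hk : ∀ z, k (-z) = k z) (hki : Integrable k)
    (hf : Integrable fun z => f (x + z) * k z) :
    jumpOperator k f x = 2 * ((∫ z, f (x + z) * k z) - f x * ∫ z, k z) := by
  have hf' := integrable_comp_sub_mul hk hf
  calc jumpOperator k f x
      = ∫ z, (f (x + z) * k z + f (x - z) * k z - 2 * f x * k z) :=
        integral_congr_ae (.of_forall fun z => by simp only [secondDiff]; ring)
    _ = (∫ z, f (x + z) * k z) + (∫ z, f (x - z) * k z) - 2 * f x * ∫ z, k z := by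
        rw [integral_sub (by exact hf.add hf') (hki.const_mul _), integral_add hf hf',
          integral_const_mul]
    _ = 2 * ((∫ z, f (x + z) * k z) - f x * ∫ z, k z) := by
        rw [integral_comp_sub_mul hk]
        ring

theorem stronglyMeasurable_jumpOperator (hk : Measurable k) (hf : Continuous f) :
    StronglyMeasurable (jumpOperator k f) := by
  have hmeas : Measurable fun p : ℝ^N × ℝ^N => secondDiff f p.1 p.2 * k p.2 := by
    refine Measurable.mul (Continuous.measurable ?_) (hk.comp measurable_snd)
    unfold secondDiff
    fun_prop
  exact hmeas.stronglyMeasurable.integral_prod_right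

end Kernel

/-- The kernel `|z|^(-N-2s)` restricted to `|z| ≥ ε`. -/
noncomputable def truncKernel (s ε : ℝ) : ℝ^N → ℝ :=
  {z | ε ≤ ‖z‖}.indicator fun z => ‖z‖ ^ (-((N : ℝ) + 2 * s))

variable {s ε R : ℝ}

theorem truncKernel_of_le {z : ℝ^N} (h : ε ≤ ‖z‖) :
    truncKernel s ε z = ‖z‖ ^ (-((N : ℝ) + 2 * s)) :=
  indicator_of_mem (s := {z : ℝ^N | ε ≤ ‖z‖}) h _

theorem truncKernel_of_lt {z : ℝ^N} (h : ‖z‖ < ε) : truncKernel s ε z = 0 :=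
  indicator_of_notMem (s := {z : ℝ^N | ε ≤ ‖z‖}) (not_le.2 h) _

theorem truncKernel_neg (s ε : ℝ) (z : ℝ^N) : truncKernel s ε (-z) = truncKernel s ε z := by
  simp only [truncKernel, indicator, mem_ofPred_eq, norm_neg]

theorem truncKernel_nonneg (s ε : ℝ) (z : ℝ^N) : 0 ≤ truncKernel s ε z :=
  indicator_nonneg (fun _ _ => by positivity) z

theorem truncKernel_le (s ε : ℝ) (z : ℝ^N) :
    truncKernel s ε z ≤ ‖z‖ ^ (-((N : ℝ) + 2 * s)) :=
  indicator_le_self' (fun _ _ => by positivity) z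

theorem measurableSet_le_norm (ε : ℝ) : MeasurableSet {z : ℝ^N | ε ≤ ‖z‖} :=
  measurableSet_le measurable_const measurable_norm

theorem measurable_truncKernel (s ε : ℝ) : Measurable (truncKernel s ε : ℝ^N → ℝ) :=
  (measurable_norm.pow_const _).indicator (measurableSet_le_norm ε)

theorem integrable_truncKernel (hN : 1 ≤ N) (hs : 0 < s) (hε : 0 < ε) :
    Integrable (truncKernel s ε : ℝ^N → ℝ) := by
  have := nontrivial_euclideanSpace hN
  have hint : Integrable (radialKernel 0 (N + 2 * s) ε : ℝ^N → ℝ) := by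
    refine integrable_radialKernel volume ?_ ?_ hε <;> rw [finrank_euclideanSpace_fin]
    · exact_mod_cast hN
    · linarith
  refine hint.mono' (measurable_truncKernel s ε).aestronglyMeasurable (.of_forall fun z => ?_)
  rw [Real.norm_of_nonneg (truncKernel_nonneg s ε z)]
  rcases le_or_gt ε ‖z‖ with h | h
  · rw [truncKernel_of_le h, radialKernel, max_eq_right h, neg_zero, Real.rpow_zero, one_mul]
  · rw [truncKernel_of_lt h]
    exact radialKernel_nonneg _ _ _ z

theorem exists_truncKernel_sub_le (N : ℕ) (hs : 0 < s) (hε : 0 < ε) (hR : 0 ≤ R) :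
    ∃ M, 0 ≤ M ∧ ∀ x y : ℝ^N, ‖x‖ ≤ R →
      truncKernel s ε (y - x) ≤ M * (1 + ‖y‖ ^ ((N : ℝ) + 2 * s))⁻¹ := by
  set q := (N : ℝ) + 2 * s
  have hq₀ : 0 < q := by positivity
  refine ⟨ε⁻¹ ^ q + (R / ε + 1) ^ q, by positivity, fun x y hx => ?_⟩
  rcases le_or_gt ε ‖y - x‖ with h | h
  · have hpos := hε.trans_le h
    have hone : 1 ≤ ε⁻¹ * ‖y - x‖ := by rwa [inv_mul_eq_div, one_le_div hε]
    have hnorm : ‖y‖ ≤ (R / ε + 1) * ‖y - x‖ := by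
      have htriangle : ‖y‖ ≤ ‖x‖ + ‖y - x‖ := by simpa using norm_add_le x (y - x)
      have := mul_le_mul_of_nonneg_left hone hR
      calc ‖y‖ ≤ R * (ε⁻¹ * ‖y - x‖) + ‖y - x‖ := by linarith
        _ = (R / ε + 1) * ‖y - x‖ := by ring
    rw [truncKernel_of_le h, Real.rpow_neg hpos.le, ← div_eq_mul_inv, inv_le_iff_one_le_mul₀
      (by positivity), div_mul_eq_mul_div, one_le_div (by positivity), add_mul,
      ← Real.mul_rpow (by positivity) hpos.le, ← Real.mul_rpow (by positivity) hpos.le]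
    exact add_le_add (Real.one_le_rpow hone hq₀.le)
      (Real.rpow_le_rpow (norm_nonneg y) hnorm hq₀.le)
  · rw [truncKernel_of_lt h]
    positivity

section MemLs

variable {f : ℝ^N → ℝ}

theorem MemLs.abs (hf : MemLs s f) : MemLs s fun x => |f x| := by
  simpa only [MemLs, abs_abs] using hf

theorem MemLs.of_hasCompactSupport (hs : 0 ≤ s) (hf : Continuous f) (hc : HasCompactSupport f) :
    MemLs s f := by
  have hden : Continuous fun x : ℝ^N => 1 + ‖x‖ ^ ((N : ℝ) + 2 * s) :=
    continuous_const.add (continuous_norm.rpow_const fun _ => Or.inr (by positivity))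
  refine Continuous.integrable_of_hasCompactSupport
    (hf.abs.div₀ hden fun x => by positivity) (hc.mono fun x hx => ?_)
  contrapose! hx
  simp_all

theorem MemLs.integrable_mul_truncKernel_sub (hfs : MemLs s f) (hs : 0 < s) (hε : 0 < ε)
    (hf : Continuous f) (x : ℝ^N) : Integrable fun y => f y * truncKernel s ε (y - x) := by
  obtain ⟨M, -, hM⟩ := exists_truncKernel_sub_le N hs hε (norm_nonneg x)
  refine (hfs.mul_const M).mono' ?_ (.of_forall fun y => ?_)
  · exact (hf.measurable.mul ((measurable_truncKernel s ε).comp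
      (measurable_id.sub_const x))).aestronglyMeasurable
  · rw [norm_mul, Real.norm_eq_abs, Real.norm_of_nonneg (truncKernel_nonneg s ε _),
      div_mul_eq_mul_div, div_eq_mul_inv, mul_assoc]
    exact mul_le_mul_of_nonneg_left (hM x y le_rfl) (abs_nonneg _)

theorem MemLs.integrable_mul_truncKernel (hfs : MemLs s f) (hs : 0 < s) (hε : 0 < ε)
    (hf : Continuous f) (x : ℝ^N) : Integrable fun z => f (x + z) * truncKernel s ε z := by
  simpa using (hfs.integrable_mul_truncKernel_sub hs hε hf x).comp_add_left x

theorem MemLs.integrable_secondDiff_mul_truncKernel (hfs : MemLs s f) (hN : 1 ≤ N) (hs : 0 < s)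
    (hε : 0 < ε) (hf : Continuous f) (x : ℝ^N) :
    Integrable fun z => secondDiff f x z * truncKernel s ε z :=
  integrable_secondDiff_mul (truncKernel_neg s ε) (integrable_truncKernel hN hs hε)
    (hfs.integrable_mul_truncKernel hs hε hf x)

theorem MemLs.jumpOperator_truncKernel_eq_sub (hfs : MemLs s f) (hN : 1 ≤ N) (hs : 0 < s)
    (hε : 0 < ε) (hf : Continuous f) (x : ℝ^N) :
    jumpOperator (truncKernel s ε) f x =
      2 * ((∫ y, f y * truncKernel s ε (y - x)) - f x * ∫ z, truncKernel (N := N) s ε z) := by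
  rw [jumpOperator_eq_sub (truncKernel_neg s ε) (integrable_truncKernel hN hs hε)
    (hfs.integrable_mul_truncKernel hs hε hf x),
    ← integral_add_left_eq_self (fun y => f y * truncKernel s ε (y - x)) x]
  simp only [add_sub_cancel_left]

theorem MemLs.fracLaplacianTrunc_eq (hfs : MemLs s f) (hN : 1 ≤ N) (hs : 0 < s) (hε : 0 < ε)
    (hf : Continuous f) (x : ℝ^N) :
    fracLaplacianTrunc s f x ε =
      -(fracLaplacianConst N s / 2 * jumpOperator (truncKernel s ε) f x) := by
  have hset : ∫ y in {y : ℝ^N | ε ≤ ‖x - y‖}, (f x - f y) / ‖x - y‖ ^ ((N : ℝ) + 2 * s) =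
      ∫ y, (f x * truncKernel s ε (y - x) - f y * truncKernel s ε (y - x)) := by
    rw [← integral_indicator (measurableSet_le measurable_const (by fun_prop))]
    congr 1
    ext y
    simp only [indicator, truncKernel, mem_ofPred_eq, norm_sub_rev x y]
    split_ifs
    · rw [Real.rpow_neg (norm_nonneg _), div_eq_mul_inv, sub_mul]
    · ring
  rw [fracLaplacianTrunc, hset, integral_sub
    (((integrable_truncKernel hN hs hε).comp_sub_right x).const_mul (f x))
    (hfs.integrable_mul_truncKernel_sub hs hε hf x), integral_const_mul,
    integral_sub_right_eq_self (truncKernel s ε), hfs.jumpOperator_truncKernel_eq_sub hN hs hε hf]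
  ring

theorem MemLs.exists_integral_abs_mul_truncKernel_le (hfs : MemLs s f) (hs : 0 < s) (hε : 0 < ε)
    (hf : Continuous f) (hR : 0 ≤ R) :
    ∃ M, ∀ x, ‖x‖ ≤ R → ∫ z, |f (x + z)| * truncKernel s ε z ≤ M := by
  obtain ⟨M, -, hM⟩ := exists_truncKernel_sub_le N hs hε hR
  refine ⟨∫ y, |f y| / (1 + ‖y‖ ^ ((N : ℝ) + 2 * s)) * M, fun x hx => ?_⟩
  rw [← integral_sub_right_eq_self _ x]
  simp only [add_sub_cancel]
  refine integral_mono (hfs.abs.integrable_mul_truncKernel_sub hs hε hf.abs x)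
    (hfs.mul_const M) fun y => ?_
  rw [div_mul_eq_mul_div, mul_div_assoc]
  exact mul_le_mul_of_nonneg_left (hM x y hx) (abs_nonneg _)

theorem abs_secondDiff_mul_truncKernel_le {x z : ℝ^N} {B U : ℝ} (hB₀ : 0 ≤ B)
    (hB : ‖z‖ ≤ 1 → |secondDiff f x z| ≤ B * ‖z‖ ^ 2) (hU : |f x| ≤ U) (hε : ε ≤ 1) :
    |secondDiff f x z * truncKernel s ε z| ≤
      B * radialKernel (N + 2 * s - 2) 2 1 z + |f (x + z)| * truncKernel s 1 z +
        |f (x - z)| * truncKernel s 1 z + 2 * U * truncKernel s 1 z := by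
  rw [abs_mul, abs_of_nonneg (truncKernel_nonneg s ε z)]
  rcases lt_or_ge ‖z‖ 1 with hz | hz
  · rw [truncKernel_of_lt hz, radialKernel, max_eq_left hz.le, Real.one_rpow]
    simp only [mul_zero, mul_one, add_zero]
    rcases eq_or_ne z 0 with rfl | hz₀
    · rw [secondDiff_zero, abs_zero, zero_mul]
      positivity
    · rw [show -((N : ℝ) + 2 * s - 2) = 2 + -(N + 2 * s) by ring,
        Real.rpow_add (norm_pos_iff.2 hz₀), Real.rpow_two, ← mul_assoc]
      exact mul_le_mul (hB hz.le) (truncKernel_le s ε z) (truncKernel_nonneg s ε z)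
        (by positivity)
  · have hsecond : |secondDiff f x z| ≤ |f (x + z)| + |f (x - z)| + 2 * U := by
      have h₁ := abs_le.1 (le_refl |f (x + z)|)
      have h₂ := abs_le.1 (le_refl |f (x - z)|)
      have h₃ := abs_le.1 hU
      rw [secondDiff, abs_le]
      constructor <;> linarith
    have hrad₀ := mul_nonneg hB₀ (radialKernel_nonneg (N + 2 * s - 2) 2 1 z)
    rw [truncKernel_of_le (hε.trans hz), ← truncKernel_of_le hz]
    linarith [mul_le_mul_of_nonneg_right hsecond (truncKernel_nonneg s 1 z)]

theorem MemLs.exists_abs_jumpOperator_le (hfs : MemLs s f) (hN : 1 ≤ N) (hs₀ : 0 < s)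
    (hs₁ : s < 1) (hf : ContDiff ℝ 2 f) (hR : 0 ≤ R) :
    ∃ M, ∀ ε x, ε ≤ 1 → ‖x‖ ≤ R → |jumpOperator (truncKernel s ε) f x| ≤ M := by
  have := nontrivial_euclideanSpace hN
  obtain ⟨B, hB₀, hB⟩ := exists_abs_secondDiff_le_of_contDiff hf R
  obtain ⟨M, hM⟩ := hfs.exists_integral_abs_mul_truncKernel_le hs₀ one_pos hf.continuous hR
  obtain ⟨U, hU⟩ := (isCompact_closedBall (0 : ℝ^N) R).exists_bound_of_continuousOn
    hf.continuous.continuousOn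
  have hrad : Integrable (radialKernel (N + 2 * s - 2) 2 1 : ℝ^N → ℝ) := by
    refine integrable_radialKernel volume ?_ ?_ one_pos <;>
      rw [finrank_euclideanSpace_fin] <;> linarith
  have hker := integrable_truncKernel hN hs₀ one_pos
  refine ⟨B * (∫ z : ℝ^N, radialKernel (N + 2 * s - 2) 2 1 z) + M + M +
    2 * U * ∫ z : ℝ^N, truncKernel s 1 z, fun ε x hε hx => ?_⟩
  have hplus := hfs.abs.integrable_mul_truncKernel hs₀ one_pos hf.continuous.abs x
  have hminus := integrable_comp_sub_mul (f := fun y => |f y|) (truncKernel_neg s 1) hplus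
  have hmajorant := ((hrad.const_mul B).add hplus).add hminus |>.add (hker.const_mul (2 * U))
  have hbound : ∀ z, ‖secondDiff f x z * truncKernel s ε z‖ ≤ _ := fun z =>
    abs_secondDiff_mul_truncKernel_le hB₀ (hB x z hx) (hU x (mem_closedBall_zero_iff.2 hx)) hε
  refine (norm_integral_le_of_norm_le hmajorant (.of_forall hbound)).trans ?_
  rw [integral_add' (((hrad.const_mul B).add hplus).add hminus) (hker.const_mul (2 * U)),
    integral_add' ((hrad.const_mul B).add hplus) hminus,
    integral_add' (hrad.const_mul B) hplus, integral_const_mul, integral_const_mul,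
    integral_comp_sub_mul (truncKernel_neg s 1) fun y => |f y|]
  have := hM x hx
  gcongr

end MemLs

end JumpOperator

section Symmetry

section Translation

variable {G : Type*} [AddCommGroup G]

theorem mul_secondDiff_eq (f g : G → ℝ) (x v : G) :
    f x * secondDiff g x v = f x * g (x + v) + f x * g (x + -v) - 2 * (f x * g (x + 0)) := by
  simp only [secondDiff, add_zero, sub_eq_add_neg]
  ring

variable [MeasurableSpace G] {μ : Measure G} {f g : G → ℝ}

theorem integrable_mul_secondDiff (hfg : ∀ v, Integrable (fun x => f x * g (x + v)) μ) (v : G) :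
    Integrable (fun x => f x * secondDiff g x v) μ := by
  simp only [mul_secondDiff_eq]
  exact ((hfg v).add (hfg (-v))).sub ((hfg 0).const_mul 2)

theorem integral_mul_secondDiff (hfg : ∀ v, Integrable (fun x => f x * g (x + v)) μ) (v : G) :
    ∫ x, f x * secondDiff g x v ∂μ = (∫ x, f x * g (x + v) ∂μ) + (∫ x, f x * g (x + -v) ∂μ) -
      2 * ∫ x, f x * g (x + 0) ∂μ := by
  simp only [mul_secondDiff_eq]
  rw [integral_sub (by exact (hfg v).add (hfg (-v))) ((hfg 0).const_mul 2),
    integral_add (hfg v) (hfg (-v)), integral_const_mul]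

variable [MeasurableAdd G] [μ.IsAddRightInvariant]

theorem integrable_mul_comp_add_comm (hfg : ∀ v, Integrable (fun x => f x * g (x + v)) μ) (v : G) :
    Integrable (fun x => g x * f (x + v)) μ := by
  simpa [mul_comm] using (hfg (-v)).comp_add_right v

theorem integral_mul_secondDiff_comm (hfg : ∀ v, Integrable (fun x => f x * g (x + v)) μ) (v : G) :
    ∫ x, f x * secondDiff g x v ∂μ = ∫ x, g x * secondDiff f x v ∂μ := by
  have htranslate : ∀ v, ∫ x, f x * g (x + v) ∂μ = ∫ x, g x * f (x + -v) ∂μ := fun v => by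
    rw [← integral_add_right_eq_self _ (-v)]
    simp only [neg_add_cancel_right, mul_comm]
  rw [integral_mul_secondDiff hfg, integral_mul_secondDiff (integrable_mul_comp_add_comm hfg),
    htranslate v, htranslate (-v), htranslate 0, neg_neg, neg_zero]
  ring

end Translation

variable {N : ℕ} {s ε : ℝ} {φ w : ℝ^N → ℝ}

theorem integrable_mul_comp_add (hφ : Continuous φ) (hc : HasCompactSupport φ) (hw : Continuous w)
    (v : ℝ^N) : Integrable fun x => φ x * w (x + v) :=
  (hφ.mul (by fun_prop)).integrable_of_hasCompactSupport hc.mul_right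

theorem MemLs.integrable_prod_mul_truncKernel (hws : MemLs s w) (hs : 0 < s) (hε : 0 < ε)
    (hφ : Continuous φ) (hc : HasCompactSupport φ) (hw : Continuous w) :
    Integrable (fun a : ℝ^N × ℝ^N => φ a.1 * (w a.2 * truncKernel s ε (a.2 - a.1)))
      (volume.prod volume) := by
  obtain ⟨R, hR₀, hR⟩ := hc.isCompact.isBounded.subset_closedBall_lt 0 0
  obtain ⟨M, -, hM⟩ := exists_truncKernel_sub_le N hs hε hR₀.le
  have hmeas : Measurable fun a : ℝ^N × ℝ^N => φ a.1 * (w a.2 * truncKernel s ε (a.2 - a.1)) :=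
    (hφ.measurable.comp measurable_fst).mul ((hw.measurable.comp measurable_snd).mul
      ((measurable_truncKernel s ε).comp (measurable_snd.sub measurable_fst)))
  refine ((hφ.abs.integrable_of_hasCompactSupport hc.abs).mul_prod (hws.mul_const M)).mono'
    hmeas.aestronglyMeasurable (.of_forall fun a => ?_)
  rw [norm_mul, norm_mul, Real.norm_of_nonneg (truncKernel_nonneg s ε _)]
  rcases eq_or_ne (φ a.1) 0 with h | h
  · simp [h]
  · rw [div_mul_eq_mul_div, mul_div_assoc, div_eq_mul_inv]
    have := hM a.1 a.2 (mem_closedBall_zero_iff.1 (hR (subset_tsupport φ h)))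
    exact mul_le_mul_of_nonneg_left (mul_le_mul_of_nonneg_left this (abs_nonneg _)) (norm_nonneg _)

theorem MemLs.integrable_mul_jumpOperator (hws : MemLs s w) (hN : 1 ≤ N) (hs : 0 < s) (hε : 0 < ε)
    (hφ : Continuous φ) (hc : HasCompactSupport φ) (hw : Continuous w) :
    Integrable (fun x => φ x * jumpOperator (truncKernel s ε) w x) ∧
      Integrable (fun x => w x * jumpOperator (truncKernel s ε) φ x) ∧
      ∫ x, φ x * jumpOperator (truncKernel s ε) w x =
        ∫ x, w x * jumpOperator (truncKernel s ε) φ x := by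
  have hφs := MemLs.of_hasCompactSupport hs.le hφ hc
  set m := ∫ z, truncKernel (N := N) s ε z with hm
  have hprod := hws.integrable_prod_mul_truncKernel hs hε hφ hc hw
  have hdiag : Integrable fun x => φ x * w x := by
    simpa using integrable_mul_comp_add hφ hc hw 0
  have hleft : Integrable fun x => ∫ y, φ x * (w y * truncKernel s ε (y - x)) :=
    hprod.integral_prod_left
  have hright : Integrable fun y => ∫ x, φ x * (w y * truncKernel s ε (y - x)) :=
    hprod.integral_prod_right
  have hφw : (fun x => φ x * jumpOperator (truncKernel s ε) w x) = fun x =>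
      2 * (∫ y, φ x * (w y * truncKernel s ε (y - x))) - 2 * m * (φ x * w x) := by
    ext x
    rw [hws.jumpOperator_truncKernel_eq_sub hN hs hε hw, integral_const_mul, ← hm]
    ring
  have hwφ : (fun x => w x * jumpOperator (truncKernel s ε) φ x) = fun y =>
      2 * (∫ x, φ x * (w y * truncKernel s ε (y - x))) - 2 * m * (φ y * w y) := by
    ext y
    have hswap : ∀ x, φ x * (w y * truncKernel s ε (y - x)) =
        w y * (φ x * truncKernel s ε (x - y)) := fun x => by
      rw [← truncKernel_neg, neg_sub, mul_left_comm]
    simp only [hswap]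
    rw [hφs.jumpOperator_truncKernel_eq_sub hN hs hε hφ, integral_const_mul, ← hm]
    ring
  rw [hφw, hwφ]
  refine ⟨(hleft.const_mul 2).sub (hdiag.const_mul (2 * m)),
    (hright.const_mul 2).sub (hdiag.const_mul (2 * m)), ?_⟩
  rw [integral_sub (hleft.const_mul 2) (hdiag.const_mul (2 * m)),
    integral_sub (hright.const_mul 2) (hdiag.const_mul (2 * m)), integral_const_mul 2,
    integral_const_mul 2, integral_integral_swap hprod]

end Symmetry

section PowSubgradient

variable {p : ℝ}

/-- The subgradient `p |a|^(p-2) a` of `a ↦ |a|^p`. At `a = 0` it vanishes, whatever the value of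
`0 ^ (p - 2)`. -/
noncomputable def powSubgradient (p a : ℝ) : ℝ :=
  p * |a| ^ (p - 2) * a

theorem measurable_powSubgradient (p : ℝ) : Measurable (powSubgradient p) :=
  (measurable_const.mul (measurable_id.abs.pow_const _)).mul measurable_id

theorem powSubgradient_mul_self (hp : p ≠ 0) (a : ℝ) : powSubgradient p a * a = p * |a| ^ p := by
  rcases eq_or_ne a 0 with rfl | ha
  · simp [Real.zero_rpow hp]
  · rw [powSubgradient, mul_assoc, mul_assoc, ← sq, ← sq_abs, ← Real.rpow_two,
      ← Real.rpow_add (abs_pos.2 ha), sub_add_cancel]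

theorem abs_powSubgradient_mul_abs (hp : 1 ≤ p) (a : ℝ) :
    |powSubgradient p a| * |a| = p * |a| ^ p := by
  rw [← abs_mul, powSubgradient_mul_self (by positivity), abs_of_nonneg (by positivity)]

theorem abs_powSubgradient (hp : 1 ≤ p) {a : ℝ} (ha : a ≠ 0) :
    |powSubgradient p a| = p * |a| ^ (p - 1) := by
  have ha' := abs_ne_zero.2 ha
  refine mul_right_cancel₀ ha' ?_
  rw [abs_powSubgradient_mul_abs hp, Real.rpow_sub_one ha']
  field_simp

theorem abs_powSubgradient_le (hp : 1 ≤ p) {a U : ℝ} (ha : |a| ≤ U) :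
    |powSubgradient p a| ≤ p * U ^ (p - 1) := by
  have hU := (abs_nonneg a).trans ha
  rcases eq_or_ne a 0 with rfl | ha₀
  · rw [powSubgradient, mul_zero, abs_zero]
    positivity
  · rw [abs_powSubgradient hp ha₀]
    gcongr

theorem powSubgradient_mul_sub_le (hp : 1 ≤ p) (a b : ℝ) :
    powSubgradient p a * (b - a) ≤ |b| ^ p - |a| ^ p := by
  rcases eq_or_ne a 0 with rfl | ha₀
  · rw [powSubgradient, mul_zero, zero_mul, abs_zero, Real.zero_rpow (by positivity), sub_zero]
    positivity
  have ha := abs_pos.2 ha₀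
  have hbernoulli := one_add_mul_self_le_rpow_one_add (s := |b| / |a| - 1)
    (by linarith [div_nonneg (abs_nonneg b) (abs_nonneg a)]) hp
  rw [add_sub_cancel, Real.div_rpow (abs_nonneg b) (abs_nonneg a),
    le_div_iff₀ (by positivity)] at hbernoulli
  calc powSubgradient p a * (b - a)
      ≤ |powSubgradient p a| * |b| - powSubgradient p a * a := by
        rw [mul_sub, ← abs_mul]
        exact sub_le_sub_right (le_abs_self _) _
    _ = (1 + p * (|b| / |a| - 1)) * |a| ^ p - |a| ^ p := by
        rw [abs_powSubgradient hp ha₀, powSubgradient_mul_self (by positivity),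
          Real.rpow_sub_one ha.ne']
        field_simp
        ring
    _ ≤ |b| ^ p - |a| ^ p := sub_le_sub_right hbernoulli _

theorem powSubgradient_mul_secondDiff_le {G : Type*} [AddGroup G] (hp : 1 ≤ p) (u : G → ℝ)
    (x z : G) :
    powSubgradient p (u x) * secondDiff u x z ≤ secondDiff (fun y => |u y| ^ p) x z := by
  have hplus := powSubgradient_mul_sub_le hp (u x) (u (x + z))
  have hminus := powSubgradient_mul_sub_le hp (u x) (u (x - z))
  unfold secondDiff
  linarith

end PowSubgradient

section MixedOperator

variable {N : ℕ} {s h p : ℝ} {φ u w : ℝ^N → ℝ}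

/-- The approximation of the mixed operator `Δ - (-Δ)^s` that replaces `Δ` by the discrete Laplacian
with step `h` and truncates the singular integral at distance `h`. -/
noncomputable def mixedTrunc (s h : ℝ) (f : ℝ^N → ℝ) (x : ℝ^N) : ℝ :=
  discreteLaplacian (EuclideanSpace.basisFun (Fin N) ℝ) f h x +
    fracLaplacianConst N s / 2 * jumpOperator (truncKernel s h) f x

theorem fracLaplacianConst_pos (N : ℕ) (hs₀ : 0 < s) (hs₁ : s < 1) :
    0 < fracLaplacianConst N s := by
  have _hnum : 0 < Real.Gamma (((N : ℝ) + 2 * s) / 2) := Real.Gamma_pos_of_pos (by positivity)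
  have _hden : 0 < Real.Gamma (1 - s) := Real.Gamma_pos_of_pos (by linarith)
  unfold fracLaplacianConst
  positivity

theorem tendsto_mixedTrunc (hN : 1 ≤ N) (hs : 0 < s) (hu : ContDiff ℝ 2 u) (hus : MemLs s u)
    {x : ℝ^N} {ℓ : ℝ} (hℓ : HasFracLaplacianAt s u ℓ x) :
    Tendsto (fun h => mixedTrunc s h u x) (𝓝[>] 0)
      (𝓝 ((Laplacian.laplacian u : ℝ^N → ℝ) x - ℓ)) := by
  have htrunc : Tendsto (fun h => fracLaplacianConst N s / 2 * jumpOperator (truncKernel s h) u x)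
      (𝓝[>] 0) (𝓝 (-ℓ)) := by
    refine hℓ.neg.congr' ?_
    filter_upwards [self_mem_nhdsWithin] with h (hh : 0 < h)
    rw [hus.fracLaplacianTrunc_eq hN hs hh hu.continuous, neg_neg]
  rw [sub_eq_add_neg]
  exact (tendsto_discreteLaplacian _ hu x).add htrunc

theorem continuous_discreteLaplacian {f : ℝ^N → ℝ} (hf : Continuous f) (h : ℝ) :
    Continuous fun x => discreteLaplacian (EuclideanSpace.basisFun (Fin N) ℝ) f h x := by
  unfold discreteLaplacian secondDiff
  fun_prop

theorem stronglyMeasurable_mixedTrunc (hu : Continuous u) (s h : ℝ) :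
    StronglyMeasurable (mixedTrunc s h u) :=
  (continuous_discreteLaplacian hu h).stronglyMeasurable.add
    ((stronglyMeasurable_jumpOperator (measurable_truncKernel s h) hu).const_mul _)

theorem abs_discreteLaplacian_le {f : ℝ^N → ℝ} {x : ℝ^N} {B r : ℝ} (hh₀ : 0 < h) (hhr : h ≤ r)
    (hB : ∀ z, ‖z‖ ≤ r → |secondDiff f x z| ≤ B * ‖z‖ ^ 2) :
    |discreteLaplacian (EuclideanSpace.basisFun (Fin N) ℝ) f h x| ≤ N * B := by
  have hterm : ∀ i ∈ Finset.univ,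
      |secondDiff f x (h • EuclideanSpace.basisFun (Fin N) ℝ i) / h ^ 2| ≤ B := fun i _ => by
    have hnorm : ‖h • EuclideanSpace.basisFun (Fin N) ℝ i‖ = h := by
      rw [norm_smul, OrthonormalBasis.norm_eq_one, mul_one, Real.norm_of_nonneg hh₀.le]
    rw [abs_div, abs_of_nonneg (sq_nonneg h), div_le_iff₀ (by positivity)]
    simpa only [hnorm] using hB (h • EuclideanSpace.basisFun (Fin N) ℝ i) (hnorm.trans_le hhr)
  refine (Finset.abs_sum_le_sum_abs _ _).trans ((Finset.sum_le_card_nsmul _ _ _ hterm).trans_eq ?_)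
  rw [Finset.card_univ, Fintype.card_fin, nsmul_eq_mul]

theorem MemLs.exists_abs_mixedTrunc_le (hus : MemLs s u) (hN : 1 ≤ N) (hs₀ : 0 < s) (hs₁ : s < 1)
    (hu : ContDiff ℝ 2 u) {R : ℝ} (hR : 0 ≤ R) :
    ∃ M, ∀ h x, 0 < h → h ≤ 1 → ‖x‖ ≤ R → |mixedTrunc s h u x| ≤ M := by
  obtain ⟨B, -, hB⟩ := exists_abs_secondDiff_le_of_contDiff hu R
  obtain ⟨M, hM⟩ := hus.exists_abs_jumpOperator_le hN hs₀ hs₁ hu hR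
  have hC := fracLaplacianConst_pos N hs₀ hs₁
  refine ⟨N * B + fracLaplacianConst N s / 2 * M, fun h x hh₀ hh₁ hx => ?_⟩
  refine (abs_add_le _ _).trans
    (add_le_add (abs_discreteLaplacian_le hh₀ hh₁ fun z hz => hB x z hx hz) ?_)
  rw [abs_mul, abs_of_nonneg (by positivity)]
  exact mul_le_mul_of_nonneg_left (hM h x hh₁ hx) (by positivity)

/-- Kato's inequality for the discretized operator. -/
theorem powSubgradient_mul_mixedTrunc_le (hp : 1 ≤ p) (hN : 1 ≤ N) (hs₀ : 0 < s) (hs₁ : s < 1)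
    (hh : 0 < h) (hu : Continuous u) (hus : MemLs s u) (hws : MemLs s fun y => |u y| ^ p)
    (x : ℝ^N) :
    powSubgradient p (u x) * mixedTrunc s h u x ≤ mixedTrunc s h (fun y => |u y| ^ p) x := by
  have hw : Continuous fun y => |u y| ^ p := hu.abs.rpow_const fun _ => Or.inr (by linarith)
  have hC := fracLaplacianConst_pos N hs₀ hs₁
  have hdisc : powSubgradient p (u x) *
      discreteLaplacian (EuclideanSpace.basisFun (Fin N) ℝ) u h x ≤
        discreteLaplacian (EuclideanSpace.basisFun (Fin N) ℝ) (fun y => |u y| ^ p) h x := by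
    rw [discreteLaplacian, Finset.mul_sum]
    refine Finset.sum_le_sum fun i _ => ?_
    rw [← mul_div_assoc]
    exact div_le_div_of_nonneg_right (powSubgradient_mul_secondDiff_le hp u _ _) (sq_nonneg h)
  have hjump : powSubgradient p (u x) * jumpOperator (truncKernel s h) u x ≤
      jumpOperator (truncKernel s h) (fun y => |u y| ^ p) x := by
    rw [jumpOperator, ← integral_const_mul]
    refine integral_mono ((hus.integrable_secondDiff_mul_truncKernel hN hs₀ hh hu x).const_mul _)
      (hws.integrable_secondDiff_mul_truncKernel hN hs₀ hh hw x) fun z => ?_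
    simp only [← mul_assoc]
    exact mul_le_mul_of_nonneg_right (powSubgradient_mul_secondDiff_le hp u _ _)
      (truncKernel_nonneg s h z)
  unfold mixedTrunc
  nlinarith [mul_le_mul_of_nonneg_left hjump (half_pos hC).le]

theorem mul_discreteLaplacian_eq (f g : ℝ^N → ℝ) (h : ℝ) (x : ℝ^N) :
    f x * discreteLaplacian (EuclideanSpace.basisFun (Fin N) ℝ) g h x =
      ∑ i, f x * secondDiff g x (h • EuclideanSpace.basisFun (Fin N) ℝ i) / h ^ 2 := by
  simp only [discreteLaplacian, Finset.mul_sum, mul_div_assoc]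

theorem integrable_mul_discreteLaplacian (h : ℝ) (hφw : ∀ v, Integrable fun x => φ x * w (x + v)) :
    Integrable fun x => φ x * discreteLaplacian (EuclideanSpace.basisFun (Fin N) ℝ) w h x := by
  simp only [mul_discreteLaplacian_eq]
  exact integrable_finsetSum _ fun i _ => (integrable_mul_secondDiff hφw _).div_const _

theorem integral_mul_discreteLaplacian_comm (h : ℝ)
    (hφw : ∀ v, Integrable fun x => φ x * w (x + v)) :
    ∫ x, φ x * discreteLaplacian (EuclideanSpace.basisFun (Fin N) ℝ) w h x =
      ∫ x, w x * discreteLaplacian (EuclideanSpace.basisFun (Fin N) ℝ) φ h x := by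
  have hwφ := integrable_mul_comp_add_comm hφw
  simp only [mul_discreteLaplacian_eq]
  rw [integral_finsetSum _ fun i _ => (integrable_mul_secondDiff hφw _).div_const _,
    integral_finsetSum _ fun i _ => (integrable_mul_secondDiff hwφ _).div_const _]
  simp only [integral_div, integral_mul_secondDiff_comm hφw]

theorem MemLs.integrable_mul_mixedTrunc (hws : MemLs s w) (hN : 1 ≤ N) (hs : 0 < s) (hh : 0 < h)
    (hφ : Continuous φ) (hc : HasCompactSupport φ) (hw : Continuous w) :
    Integrable (fun x => φ x * mixedTrunc s h w x) ∧
      Integrable (fun x => w x * mixedTrunc s h φ x) ∧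
      ∫ x, φ x * mixedTrunc s h w x = ∫ x, w x * mixedTrunc s h φ x := by
  have hint := integrable_mul_comp_add hφ hc hw
  have hφw := integrable_mul_discreteLaplacian h hint
  have hwφ := integrable_mul_discreteLaplacian h (integrable_mul_comp_add_comm hint)
  obtain ⟨hφw', hwφ', hcomm⟩ := hws.integrable_mul_jumpOperator hN hs hh hφ hc hw
  set C := fracLaplacianConst N s / 2 with hC
  have hexpand : ∀ f g : ℝ^N → ℝ, (fun x => f x * mixedTrunc s h g x) = fun x =>
      f x * discreteLaplacian (EuclideanSpace.basisFun (Fin N) ℝ) g h x +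
        C * (f x * jumpOperator (truncKernel s h) g x) := fun f g => by
    ext x
    rw [mixedTrunc, ← hC]
    ring
  rw [hexpand, hexpand]
  refine ⟨hφw.add (hφw'.const_mul C), hwφ.add (hwφ'.const_mul C), ?_⟩
  rw [integral_add hφw (hφw'.const_mul C), integral_add hwφ (hwφ'.const_mul C), integral_const_mul,
    integral_const_mul,
    integral_mul_discreteLaplacian_comm h hint, hcomm]

end MixedOperator

section GaussianMixture

variable {N : ℕ} {t τ : ℝ} {g k : ℝ → ENNReal}

/-- The centred Gaussian probability density of covariance `t / 2`, which is the heat kernel at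
time `t / 4`. -/
noncomputable def heatKernel (t : ℝ) (x : ℝ^N) : ℝ :=
  (Real.pi * t) ^ (-(N : ℝ) / 2) * Real.exp (-‖x‖ ^ 2 / t)

theorem heatKernel_nonneg (ht : 0 ≤ t) (x : ℝ^N) : 0 ≤ heatKernel t x := by
  unfold heatKernel
  positivity

theorem heatKernel_neg (t : ℝ) (x : ℝ^N) : heatKernel t (-x) = heatKernel t x := by
  simp only [heatKernel, norm_neg]

@[fun_prop]
theorem measurable_heatKernel : Measurable fun p : ℝ × ℝ^N => heatKernel p.1 p.2 := by
  unfold heatKernel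
  fun_prop

theorem integral_heatKernel (ht : 0 < t) : ∫ z : ℝ^N, heatKernel t z = 1 := by
  have hexp (z : ℝ^N) : -‖z‖ ^ 2 / t = -t⁻¹ * ‖z‖ ^ 2 := by ring
  simp only [heatKernel, hexp]
  rw [integral_const_mul, GaussianFourier.integral_rexp_neg_mul_sq_norm (by positivity),
    finrank_euclideanSpace, Fintype.card_fin, div_inv_eq_mul, neg_div,
    ← Real.rpow_add (by positivity), neg_add_cancel, Real.rpow_zero]

theorem lintegral_heatKernel (ht : 0 < t) : ∫⁻ z : ℝ^N, ENNReal.ofReal (heatKernel t z) = 1 := by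
  rw [← ofReal_integral_eq_lintegral_ofReal, integral_heatKernel ht, ENNReal.ofReal_one]
  · exact .of_integral_ne_zero (by simp [integral_heatKernel ht])
  · exact .of_forall (heatKernel_nonneg ht.le)

theorem heatKernel_mul_heatKernel (hτ : 0 < τ) (ht : 0 < t) (x z : ℝ^N) :
    heatKernel τ z * heatKernel t (x + z) =
      heatKernel (τ + t) x * heatKernel (τ * t / (τ + t)) ((τ / (τ + t)) • x + z) := by
  have hsq : -‖z‖ ^ 2 / τ + -‖x + z‖ ^ 2 / t =
      -‖x‖ ^ 2 / (τ + t) + -‖(τ / (τ + t)) • x + z‖ ^ 2 / (τ * t / (τ + t)) := by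
    rw [norm_add_sq_real, norm_add_sq_real, real_inner_smul_left, norm_smul, mul_pow,
      Real.norm_eq_abs, sq_abs]
    field_simp
    ring
  have hpow : (Real.pi * τ) ^ (-(N : ℝ) / 2) * (Real.pi * t) ^ (-(N : ℝ) / 2) =
      (Real.pi * (τ + t)) ^ (-(N : ℝ) / 2) *
        (Real.pi * (τ * t / (τ + t))) ^ (-(N : ℝ) / 2) := by
    rw [← Real.mul_rpow (by positivity) (by positivity),
      ← Real.mul_rpow (by positivity) (by positivity)]
    congr 1
    field_simp
  simp only [heatKernel]
  rw [mul_mul_mul_comm, ← Real.exp_add, hsq, hpow, Real.exp_add, mul_mul_mul_comm]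

theorem lintegral_heatKernel_mul_heatKernel (hτ : 0 < τ) (ht : 0 < t) (x : ℝ^N) :
    ∫⁻ z, ENNReal.ofReal (heatKernel τ z) * ENNReal.ofReal (heatKernel t (x + z)) =
      ENNReal.ofReal (heatKernel (τ + t) x) := by
  simp only [← ENNReal.ofReal_mul (heatKernel_nonneg hτ.le _), heatKernel_mul_heatKernel hτ ht,
    ENNReal.ofReal_mul (heatKernel_nonneg (add_pos hτ ht).le _)]
  rw [lintegral_const_mul' _ _ ENNReal.ofReal_ne_top, lintegral_add_left_eq_self
    (fun z : ℝ^N => ENNReal.ofReal (heatKernel (τ * t / (τ + t)) z)),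
    lintegral_heatKernel (by positivity), mul_one]

/-- The superposition of the Gaussians `heatKernel t` with density `g t`. -/
noncomputable def gaussianMixture (g : ℝ → ENNReal) (x : ℝ^N) : ENNReal :=
  ∫⁻ t, g t * ENNReal.ofReal (heatKernel t x)

theorem gaussianMixture_neg (g : ℝ → ENNReal) (x : ℝ^N) :
    gaussianMixture g (-x) = gaussianMixture g x := by
  simp only [gaussianMixture, heatKernel_neg]

theorem gaussianMixture_mono (h : g ≤ k) (x : ℝ^N) : gaussianMixture g x ≤ gaussianMixture k x :=
  lintegral_mono fun t => mul_le_mul_left (h t) _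

theorem measurable_gaussianMixture (hg : Measurable g) :
    Measurable (gaussianMixture g : ℝ^N → ENNReal) := by
  unfold gaussianMixture
  exact Measurable.lintegral_prod_right' (f := fun p : ℝ^N × ℝ =>
    g p.2 * ENNReal.ofReal (heatKernel p.2 p.1)) (by fun_prop)

theorem lintegral_gaussianMixture (hg : Measurable g) (hg₀ : ∀ t ≤ 0, g t = 0) :
    ∫⁻ z : ℝ^N, gaussianMixture g z = ∫⁻ t, g t := by
  unfold gaussianMixture
  rw [lintegral_lintegral_swap (by fun_prop)]
  refine lintegral_congr fun t => ?_
  rcases le_or_gt t 0 with ht | ht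
  · simp [hg₀ t ht]
  · rw [lintegral_const_mul _ (by fun_prop), lintegral_heatKernel ht, mul_one]

theorem lintegral_gaussianMixture_mul_comp_add (hk : Measurable k) (hk₀ : ∀ t ≤ 0, k t = 0)
    (hg : Measurable g) (hg₀ : ∀ t ≤ 0, g t = 0) (x : ℝ^N) :
    ∫⁻ z, gaussianMixture k z * gaussianMixture g (x + z) =
      gaussianMixture (k ⋆ₗ g) x := by
  have hz (τ t : ℝ) : ∫⁻ z : ℝ^N, k τ * ENNReal.ofReal (heatKernel τ z) *
      (g t * ENNReal.ofReal (heatKernel t (x + z))) =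
      k τ * (g t * ENNReal.ofReal (heatKernel (τ + t) x)) := by
    rcases le_or_gt τ 0 with hτ | hτ
    · simp [hk₀ τ hτ]
    rcases le_or_gt t 0 with ht | ht
    · simp [hg₀ t ht]
    simp only [mul_mul_mul_comm (k τ)]
    rw [lintegral_const_mul _ (by fun_prop), lintegral_heatKernel_mul_heatKernel hτ ht, mul_assoc]
  calc ∫⁻ z, gaussianMixture k z * gaussianMixture g (x + z)
      = ∫⁻ z, ∫⁻ p : ℝ × ℝ, k p.1 * ENNReal.ofReal (heatKernel p.1 z) *
          (g p.2 * ENNReal.ofReal (heatKernel p.2 (x + z))) :=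
        lintegral_congr fun z => (lintegral_prod_mul (by fun_prop) (by fun_prop)).symm
    _ = ∫⁻ p : ℝ × ℝ, k p.1 * (g p.2 * ENNReal.ofReal (heatKernel (p.1 + p.2) x)) := by
        rw [lintegral_lintegral_swap (by fun_prop)]
        exact lintegral_congr fun p => hz p.1 p.2
    _ = ∫⁻ τ, ∫⁻ t, k τ * (g (-τ + t) * ENNReal.ofReal (heatKernel t x)) := by
        rw [Measure.volume_eq_prod, lintegral_prod _ (by fun_prop)]
        refine lintegral_congr fun τ => ?_
        rw [← lintegral_add_left_eq_self
          (fun t => k τ * (g (-τ + t) * ENNReal.ofReal (heatKernel t x))) τ]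
        simp only [neg_add_cancel_left]
    _ = gaussianMixture (k ⋆ₗ g) x := by
        rw [lintegral_lintegral_swap (by fun_prop)]
        refine lintegral_congr fun t => ?_
        simp only [← mul_assoc]
        rw [lintegral_mul_const _ (by fun_prop), lconvolution_def]

end GaussianMixture

section SubordinatorDensity

variable {s b p t τ ε : ℝ}

theorem integral_rpow_mul_exp_neg_div {a : ℝ} (ha : 0 < a) (hb : 0 < b) :
    ∫ t in Ioi (0 : ℝ), t ^ (-a - 1) * Real.exp (-b / t) = Real.Gamma a * b ^ (-a) := by
  have hcomp := integral_comp_rpow_Ioi (fun y : ℝ => y ^ (a - 1) * Real.exp (-(b * y)))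
    (p := -1) (by norm_num)
  rw [Real.integral_rpow_mul_exp_neg_mul_Ioi ha hb] at hcomp
  rw [mul_comm, Real.rpow_neg hb.le, ← Real.inv_rpow hb.le, ← one_div, ← hcomp]
  refine setIntegral_congr_fun measurableSet_Ioi fun t (ht : 0 < t) => ?_
  simp only [abs_neg, abs_one, one_mul, smul_eq_mul]
  rw [← mul_assoc, ← Real.rpow_mul ht.le, ← Real.rpow_add ht, Real.rpow_neg_one]
  congr 2 <;> ring

theorem lintegral_rpow_mul_exp_neg_div {a : ℝ} (ha : 0 < a) (hb : 0 < b) :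
    ∫⁻ t in Ioi (0 : ℝ), ENNReal.ofReal (t ^ (-a - 1) * Real.exp (-b / t)) =
      ENNReal.ofReal (Real.Gamma a * b ^ (-a)) := by
  have _hΓ := Real.Gamma_pos_of_pos ha
  rw [← integral_rpow_mul_exp_neg_div ha hb, ofReal_integral_eq_lintegral_ofReal]
  · exact .of_integral_ne_zero (by rw [integral_rpow_mul_exp_neg_div ha hb]; positivity)
  · filter_upwards [ae_restrict_mem measurableSet_Ioi] with t ht
    have : 0 < t := ht
    simp only [Pi.zero_apply]
    positivity

/-- The density `t ^ (p - 1) * exp (-b / t)` on the positive half line. Mixing Gaussians with it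
gives a multiple of `(b + ‖x‖²) ^ (p - N / 2)`. -/
noncomputable def inverseGammaDensity (p b : ℝ) : ℝ → ENNReal :=
  (Ioi 0).indicator fun t => ENNReal.ofReal (t ^ (p - 1) * Real.exp (-b / t))

/-- The Lévy density `t ^ (-1 - s)` of the `s`-stable subordinator, without the jumps up to size
`ε`. -/
noncomputable def subordinatorDensity (s ε : ℝ) : ℝ → ENNReal :=
  (Ioi ε).indicator fun t => ENNReal.ofReal (t ^ (-1 - s))

@[fun_prop]
theorem measurable_inverseGammaDensity (p b : ℝ) : Measurable (inverseGammaDensity p b) :=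
  Measurable.indicator (by fun_prop) measurableSet_Ioi

@[fun_prop]
theorem measurable_subordinatorDensity (s ε : ℝ) : Measurable (subordinatorDensity s ε) :=
  Measurable.indicator (by fun_prop) measurableSet_Ioi

theorem inverseGammaDensity_of_pos (p b : ℝ) (ht : 0 < t) :
    inverseGammaDensity p b t = ENNReal.ofReal (t ^ (p - 1) * Real.exp (-b / t)) :=
  indicator_of_mem (mem_Ioi.2 ht) _

theorem inverseGammaDensity_of_nonpos (p b : ℝ) (ht : t ≤ 0) : inverseGammaDensity p b t = 0 :=
  indicator_of_notMem (notMem_Ioi.2 ht) _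

theorem subordinatorDensity_of_lt (s : ℝ) (ht : ε < t) :
    subordinatorDensity s ε t = ENNReal.ofReal (t ^ (-1 - s)) :=
  indicator_of_mem (mem_Ioi.2 ht) _

theorem subordinatorDensity_of_le (s : ℝ) (ht : t ≤ ε) : subordinatorDensity s ε t = 0 :=
  indicator_of_notMem (notMem_Ioi.2 ht) _

theorem subordinatorDensity_zero (s : ℝ) :
    subordinatorDensity s 0 = inverseGammaDensity (-s) 0 := by
  simp [subordinatorDensity, inverseGammaDensity, neg_sub_comm]

theorem subordinatorDensity_antitone (s : ℝ) : Antitone (subordinatorDensity s) :=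
  fun _ _ h => indicator_le_indicator_of_subset (Ioi_subset_Ioi h) fun _ => zero_le

theorem tendsto_subordinatorDensity (s t : ℝ) :
    Tendsto (fun ε => subordinatorDensity s ε t) (𝓝[>] 0) (𝓝 (subordinatorDensity s 0 t)) := by
  refine tendsto_const_nhds.congr' ?_
  rcases le_or_gt t 0 with ht | ht
  · filter_upwards [self_mem_nhdsWithin] with ε (hε : 0 < ε)
    rw [subordinatorDensity_of_le s ht, subordinatorDensity_of_le s (ht.trans hε.le)]
  · filter_upwards [Ioo_mem_nhdsGT ht] with ε hε
    rw [subordinatorDensity_of_lt s ht, subordinatorDensity_of_lt s hε.2]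

theorem lintegral_subordinatorDensity (hs : 0 < s) (hε : 0 < ε) :
    ∫⁻ t, subordinatorDensity s ε t = ENNReal.ofReal (ε ^ (-s) / s) := by
  unfold subordinatorDensity
  rw [lintegral_indicator measurableSet_Ioi, ← ofReal_integral_eq_lintegral_ofReal
    (integrableOn_Ioi_rpow_of_lt (by linarith) hε), integral_Ioi_rpow_of_lt (by linarith) hε]
  · rw [show -1 - s + 1 = -s by ring, neg_div_neg_eq]
  · filter_upwards [ae_restrict_mem measurableSet_Ioi] with t ht
    exact Real.rpow_nonneg (hε.trans ht).le _

theorem gaussianMixture_inverseGammaDensity {N : ℕ} {x : ℝ^N} (hp : p < N / 2)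
    (hb : 0 < b + ‖x‖ ^ 2) :
    gaussianMixture (inverseGammaDensity p b) x = ENNReal.ofReal
      (Real.pi ^ (-(N : ℝ) / 2) * (Real.Gamma (N / 2 - p) * (b + ‖x‖ ^ 2) ^ (-(N / 2 - p)))) := by
  have hdensity (t : ℝ) : inverseGammaDensity p b t * ENNReal.ofReal (heatKernel t x) =
      ENNReal.ofReal (Real.pi ^ (-(N : ℝ) / 2)) * (Ioi 0).indicator (fun t => ENNReal.ofReal
        (t ^ (-(N / 2 - p) - 1) * Real.exp (-(b + ‖x‖ ^ 2) / t))) t := by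
    rcases le_or_gt t 0 with ht | ht
    · rw [inverseGammaDensity_of_nonpos p b ht, indicator_of_notMem (notMem_Ioi.2 ht), zero_mul,
        mul_zero]
    rw [inverseGammaDensity_of_pos p b ht, indicator_of_mem (mem_Ioi.2 ht), heatKernel,
      ← ENNReal.ofReal_mul (by positivity), ← ENNReal.ofReal_mul (by positivity),
      Real.mul_rpow Real.pi_pos.le ht.le]
    congr 1
    rw [show -(N / 2 - p) - 1 = (p - 1) + -(N : ℝ) / 2 by ring, Real.rpow_add ht,
      neg_add, add_div, Real.exp_add, neg_div t (‖x‖ ^ 2)]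
    ring
  unfold gaussianMixture
  simp only [hdensity]
  rw [lintegral_const_mul' _ _ ENNReal.ofReal_ne_top, lintegral_indicator measurableSet_Ioi,
    lintegral_rpow_mul_exp_neg_div (by linarith) hb, ← ENNReal.ofReal_mul (by positivity)]

theorem hasDerivAt_sub_div_rpow (hs : 0 < s) (hτ : τ ∈ Ioo 0 t) :
    HasDerivAt (fun τ => -(((t - τ) / τ) ^ s / (s * t)))
      (τ ^ (-1 - s) * (t - τ) ^ (s - 1)) τ := by
  have hτ₀ : 0 < τ := hτ.1
  have hτt : 0 < t - τ := sub_pos.2 hτ.2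
  have ht₀ : 0 < t := hτ₀.trans hτ.2
  have hquot : HasDerivAt (fun τ => (t - τ) / τ) (-t / τ ^ 2) τ := by
    convert! ((hasDerivAt_id τ).const_sub t).div (hasDerivAt_id τ) hτ₀.ne' using 1
    simp only [id]
    ring
  convert! ((hquot.rpow_const (p := s) (.inl (by positivity))).div_const (s * t)).neg using 1
  rw [Real.div_rpow hτt.le hτ₀.le, show -1 - s = -(s - 1) - 2 by ring, Real.rpow_sub hτ₀,
    Real.rpow_neg hτ₀.le, Real.rpow_ofNat]
  field_simp

theorem lintegral_rpow_mul_sub_rpow_le (hs : 0 < s) (hε : 0 < ε) (ht : ε < t) :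
    ∫⁻ τ in Ioo ε t, ENNReal.ofReal (τ ^ (-1 - s) * (t - τ) ^ (s - 1)) ≤
      ENNReal.ofReal (ε ^ (-s) / s * t ^ (s - 1)) := by
  have ht₀ : 0 < t := hε.trans ht
  have hcont : ContinuousOn (fun τ => -(((t - τ) / τ) ^ s / (s * t))) (Icc ε t) := by
    refine (ContinuousOn.div_const (ContinuousOn.rpow_const (ContinuousOn.div (by fun_prop)
      continuousOn_id fun τ hτ => (hε.trans_le hτ.1).ne') fun τ _ => .inr hs.le) _).neg
  have hderiv (τ) (hτ : τ ∈ Ioo ε t) := hasDerivAt_sub_div_rpow hs ⟨hε.trans hτ.1, hτ.2⟩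
  have hnonneg (τ) (hτ : τ ∈ Ioo ε t) : 0 ≤ τ ^ (-1 - s) * (t - τ) ^ (s - 1) :=
    mul_nonneg (Real.rpow_nonneg (hε.trans hτ.1).le _) (Real.rpow_nonneg (sub_pos.2 hτ.2).le _)
  have hint := intervalIntegral.integrableOn_deriv_of_nonneg hcont hderiv hnonneg
  have hFTC := intervalIntegral.integral_eq_sub_of_hasDerivAt_of_le ht.le hcont hderiv
    ((intervalIntegrable_iff_integrableOn_Ioc_of_le ht.le).2 hint)
  rw [intervalIntegral.integral_of_le ht.le, integral_Ioc_eq_integral_Ioo] at hFTC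
  rw [← ofReal_integral_eq_lintegral_ofReal (hint.mono_set Ioo_subset_Ioc_self)
    ((ae_restrict_iff' measurableSet_Ioo).2 (.of_forall hnonneg)), hFTC]
  refine ENNReal.ofReal_le_ofReal ?_
  calc -(((t - t) / t) ^ s / (s * t)) - -(((t - ε) / ε) ^ s / (s * t))
      = ((t - ε) / ε) ^ s / (s * t) := by simp [Real.zero_rpow hs.ne']
    _ ≤ (t / ε) ^ s / (s * t) := by gcongr; linarith
    _ = ε ^ (-s) / s * t ^ (s - 1) := by
      rw [Real.div_rpow ht₀.le hε.le, Real.rpow_neg hε.le, Real.rpow_sub_one ht₀.ne']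
      field_simp

theorem subordinatorDensity_mul_inverseGammaDensity_le (hε : 0 ≤ ε) (hb : 0 ≤ b) (hp : s ≤ p)
    (τ t : ℝ) :
    subordinatorDensity s ε τ * inverseGammaDensity p b (t - τ) ≤
      ENNReal.ofReal (t ^ (p - s) * Real.exp (-b / t)) * (Ioo ε t).indicator
        (fun τ => ENNReal.ofReal (τ ^ (-1 - s) * (t - τ) ^ (s - 1))) τ := by
  rcases le_or_gt τ ε with hτε | hετ
  · simp [subordinatorDensity_of_le s hτε]
  rcases le_or_gt t τ with htτ | hτt
  · simp [inverseGammaDensity_of_nonpos p b (sub_nonpos.2 htτ)]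
  have hτ₀ : 0 < τ := hε.trans_lt hετ
  have ht₀ : 0 < t := hτ₀.trans hτt
  have hsub : 0 < t - τ := sub_pos.2 hτt
  rw [subordinatorDensity_of_lt s hετ, inverseGammaDensity_of_pos p b hsub,
    indicator_of_mem (show τ ∈ Ioo ε t from ⟨hετ, hτt⟩), ← ENNReal.ofReal_mul (by positivity),
    ← ENNReal.ofReal_mul (by positivity)]
  refine ENNReal.ofReal_le_ofReal ?_
  have hexp : Real.exp (-b / (t - τ)) ≤ Real.exp (-b / t) := by
    rw [Real.exp_le_exp, neg_div, neg_div, neg_le_neg_iff]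
    gcongr
    linarith
  calc τ ^ (-1 - s) * ((t - τ) ^ (p - 1) * Real.exp (-b / (t - τ)))
      = τ ^ (-1 - s) * ((t - τ) ^ (p - s) * (t - τ) ^ (s - 1) * Real.exp (-b / (t - τ))) := by
        rw [← Real.rpow_add hsub, sub_add_sub_cancel]
    _ ≤ τ ^ (-1 - s) * (t ^ (p - s) * (t - τ) ^ (s - 1) * Real.exp (-b / t)) := by
        gcongr
        linarith
    _ = t ^ (p - s) * Real.exp (-b / t) * (τ ^ (-1 - s) * (t - τ) ^ (s - 1)) := by ring

theorem lconvolution_subordinatorDensity_le (hs : 0 < s) (hε : 0 < ε) (hb : 0 ≤ b) (hp : s ≤ p)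
    (t : ℝ) :
    (subordinatorDensity s ε ⋆ₗ inverseGammaDensity p b) t ≤
      ENNReal.ofReal (ε ^ (-s) / s) * inverseGammaDensity p b t := by
  have hle := lintegral_mono (μ := volume)
    (subordinatorDensity_mul_inverseGammaDensity_le hε.le hb hp · t)
  rw [lintegral_const_mul' _ _ ENNReal.ofReal_ne_top, lintegral_indicator measurableSet_Ioo] at hle
  simp only [lconvolution_def, neg_add_eq_sub]
  refine hle.trans ?_
  rcases le_or_gt t ε with ht | ht
  · simp [Ioo_eq_empty ht.not_gt]
  have ht₀ : 0 < t := hε.trans ht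
  grw [lintegral_rpow_mul_sub_rpow_le hs hε ht]
  rw [inverseGammaDensity_of_pos p b ht₀, ← ENNReal.ofReal_mul (by positivity),
    ← ENNReal.ofReal_mul (by positivity), show p - 1 = (p - s) + (s - 1) by ring,
    Real.rpow_add ht₀]
  exact ENNReal.ofReal_le_ofReal (by linarith)

end SubordinatorDensity

section Superharmonic

variable {N : ℕ} {s β ε : ℝ}

theorem gaussianMixture_weightPsi (hβ : 0 < β) (x : ℝ^N) :
    gaussianMixture (inverseGammaDensity ((N - β) / 2) 1) x =
      ENNReal.ofReal (Real.pi ^ (-(N : ℝ) / 2) * Real.Gamma (β / 2)) *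
        ENNReal.ofReal (weightPsi β x) := by
  have _hΓ := Real.Gamma_pos_of_pos (half_pos hβ)
  rw [gaussianMixture_inverseGammaDensity (by linarith) (by positivity), ← mul_assoc,
    ENNReal.ofReal_mul (by rw [sub_div, sub_sub_cancel]; positivity), sub_div, sub_sub_cancel,
    weightPsi, neg_div _ β]

/-- The factor by which the Gaussian mixture of the full `s`-stable Lévy density exceeds the
kernel `‖z‖ ^ (-(N + 2 * s))`. -/
noncomputable def subordinationConst (N : ℕ) (s : ℝ) : ℝ :=
  Real.pi ^ (-(N : ℝ) / 2) * Real.Gamma (N / 2 + s)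

theorem subordinationConst_pos (N : ℕ) (hs : 0 < s) : 0 < subordinationConst N s := by
  have := Real.Gamma_pos_of_pos (show 0 < (N : ℝ) / 2 + s by positivity)
  unfold subordinationConst
  positivity

theorem gaussianMixture_subordinatorDensity_zero (hs : 0 < s) {z : ℝ^N} (hz : z ≠ 0) :
    gaussianMixture (subordinatorDensity s 0) z =
      ENNReal.ofReal (subordinationConst N s * ‖z‖ ^ (-((N : ℝ) + 2 * s))) := by
  have hnorm : 0 < ‖z‖ := norm_pos_iff.2 hz
  rw [subordinatorDensity_zero, gaussianMixture_inverseGammaDensity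
    (by linarith [N.cast_nonneg (α := ℝ)]) (by positivity), zero_add,
    ← Real.rpow_natCast_mul hnorm.le, sub_neg_eq_add, subordinationConst, mul_assoc]
  congr 4
  push_cast
  ring

theorem lintegral_weightPsi_mul_gaussianMixture_le (hs : 0 < s) (hβ : 0 < β)
    (hβN : β ≤ N - 2 * s) (hε : 0 < ε) (x : ℝ^N) :
    ∫⁻ z, ENNReal.ofReal (weightPsi β (x + z)) * gaussianMixture (subordinatorDensity s ε) z ≤
      ENNReal.ofReal (weightPsi β x * (ε ^ (-s) / s)) := by
  set c := ENNReal.ofReal (Real.pi ^ (-(N : ℝ) / 2) * Real.Gamma (β / 2))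
  set g := inverseGammaDensity ((N - β) / 2) 1
  have hc₀ : c ≠ 0 := by
    have := Real.Gamma_pos_of_pos (half_pos hβ)
    simp only [c, ne_eq, ENNReal.ofReal_eq_zero, not_le]
    positivity
  have hk := measurable_subordinatorDensity s ε
  refine (ENNReal.mul_le_mul_iff_right hc₀ ENNReal.ofReal_ne_top).1 ?_
  calc c * ∫⁻ z, ENNReal.ofReal (weightPsi β (x + z)) *
        gaussianMixture (subordinatorDensity s ε) z
      = ∫⁻ z, gaussianMixture (subordinatorDensity s ε) z * gaussianMixture g (x + z) := by
        rw [← lintegral_const_mul' _ _ ENNReal.ofReal_ne_top]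
        refine lintegral_congr fun z => ?_
        rw [gaussianMixture_weightPsi hβ, ← mul_assoc, mul_comm]
    _ = gaussianMixture (subordinatorDensity s ε ⋆ₗ g) x :=
        lintegral_gaussianMixture_mul_comp_add hk
          (fun t ht => subordinatorDensity_of_le s (ht.trans hε.le)) (by fun_prop)
          (fun t => inverseGammaDensity_of_nonpos _ _) x
    _ ≤ gaussianMixture (fun t => ENNReal.ofReal (ε ^ (-s) / s) * g t) x :=
        gaussianMixture_mono
          (lconvolution_subordinatorDensity_le hs hε zero_le_one (by linarith)) x
    _ = ENNReal.ofReal (ε ^ (-s) / s) * gaussianMixture g x := by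
        simp only [gaussianMixture, mul_assoc]
        rw [lintegral_const_mul' _ _ ENNReal.ofReal_ne_top]
    _ = c * ENNReal.ofReal (weightPsi β x * (ε ^ (-s) / s)) := by
        rw [gaussianMixture_weightPsi hβ, ENNReal.ofReal_mul (weightPsi_pos β x).le]
        ring

/-- The jump intensity of the `2 * s`-stable process obtained by subordinating Brownian motion,
without the jumps of the subordinator up to size `ε`. -/
noncomputable def subordinatedKernel (s ε : ℝ) (z : ℝ^N) : ℝ :=
  (gaussianMixture (subordinatorDensity s ε) z).toReal

theorem measurable_subordinatedKernel (s ε : ℝ) :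
    Measurable (subordinatedKernel s ε : ℝ^N → ℝ) :=
  (measurable_gaussianMixture (measurable_subordinatorDensity s ε)).ennreal_toReal

theorem lintegral_gaussianMixture_subordinatorDensity (hs : 0 < s) (hε : 0 < ε) :
    ∫⁻ z : ℝ^N, gaussianMixture (subordinatorDensity s ε) z = ENNReal.ofReal (ε ^ (-s) / s) := by
  rw [lintegral_gaussianMixture (measurable_subordinatorDensity s ε)
    fun t ht => subordinatorDensity_of_le s (ht.trans hε.le), lintegral_subordinatorDensity hs hε]

theorem subordinatedKernel_le (hs : 0 < s) (hε : 0 ≤ ε) {z : ℝ^N} (hz : z ≠ 0) :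
    subordinatedKernel s ε z ≤
      subordinationConst N s * ‖z‖ ^ (-((N : ℝ) + 2 * s)) := by
  refine ENNReal.toReal_le_of_le_ofReal
    (mul_nonneg (subordinationConst_pos N hs).le (by positivity)) ?_
  rw [← gaussianMixture_subordinatorDensity_zero hs hz]
  exact gaussianMixture_mono (subordinatorDensity_antitone s hε) z

theorem tendsto_subordinatedKernel (hs : 0 < s) {z : ℝ^N} (hz : z ≠ 0) :
    Tendsto (fun ε => subordinatedKernel s ε z) (𝓝[>] 0)
      (𝓝 (subordinationConst N s * ‖z‖ ^ (-((N : ℝ) + 2 * s)))) := by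
  have hzero := gaussianMixture_subordinatorDensity_zero hs hz
  have hlim : Tendsto (fun ε => gaussianMixture (subordinatorDensity s ε) z) (𝓝[>] 0)
      (𝓝 (gaussianMixture (subordinatorDensity s 0) z)) := by
    refine tendsto_lintegral_filter_of_dominated_convergence
      (fun t => subordinatorDensity s 0 t * ENNReal.ofReal (heatKernel t z))
      (.of_forall fun ε => by fun_prop) ?_ (hzero.trans_ne ENNReal.ofReal_ne_top)
      (.of_forall fun t => ENNReal.Tendsto.mul_const (tendsto_subordinatorDensity s t)
        (.inr ENNReal.ofReal_ne_top))
    filter_upwards [self_mem_nhdsWithin] with ε hε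
    exact .of_forall fun t => mul_le_mul_left (subordinatorDensity_antitone s (le_of_lt hε) t) _
  rw [hzero] at hlim
  have htoReal := (ENNReal.tendsto_toReal ENNReal.ofReal_ne_top).comp hlim
  rwa [ENNReal.toReal_ofReal (mul_nonneg (subordinationConst_pos N hs).le (by positivity))]
    at htoReal

theorem jumpOperator_subordinatedKernel_weightPsi_nonpos (hs : 0 < s) (hβ : 0 < β)
    (hβN : β ≤ N - 2 * s) (hε : 0 < ε) (x : ℝ^N) :
    jumpOperator (subordinatedKernel s ε) (weightPsi β) x ≤ 0 := by
  have hmix : Measurable (gaussianMixture (subordinatorDensity s ε) : ℝ^N → ENNReal) :=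
    measurable_gaussianMixture (measurable_subordinatorDensity s ε)
  have hψ : Measurable fun z => ENNReal.ofReal (weightPsi β (x + z)) :=
    ((continuous_weightPsi β).comp (continuous_const_add x)).measurable.ennreal_ofReal
  have hmass := lintegral_gaussianMixture_subordinatorDensity (N := N) hs hε
  have hle := lintegral_weightPsi_mul_gaussianMixture_le hs hβ hβN hε x
  have hmass_ne := hmass.trans_ne ENNReal.ofReal_ne_top
  have hle_ne := (hle.trans_lt ENNReal.ofReal_lt_top).ne
  have hprod (z : ℝ^N) : weightPsi β (x + z) * subordinatedKernel s ε z =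
      (ENNReal.ofReal (weightPsi β (x + z)) *
        gaussianMixture (subordinatorDensity s ε) z).toReal := by
    rw [ENNReal.toReal_mul, ENNReal.toReal_ofReal (weightPsi_pos β _).le, subordinatedKernel]
  have hk : ∫ z : ℝ^N, subordinatedKernel s ε z = ε ^ (-s) / s := by
    unfold subordinatedKernel
    rw [integral_toReal hmix.aemeasurable (ae_lt_top hmix hmass_ne), hmass,
      ENNReal.toReal_ofReal (by positivity)]
  have hψk : ∫ z, weightPsi β (x + z) * subordinatedKernel s ε z ≤
      weightPsi β x * (ε ^ (-s) / s) := by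
    simp only [hprod]
    rw [integral_toReal (by fun_prop) (ae_lt_top (by fun_prop) hle_ne)]
    exact ENNReal.toReal_le_of_le_ofReal
      (mul_nonneg (weightPsi_pos β x).le (by positivity)) hle
  rw [jumpOperator_eq_sub (k := subordinatedKernel s ε)
    (fun z => by simp only [subordinatedKernel, gaussianMixture_neg])
    (integrable_toReal_of_lintegral_ne_top hmix.aemeasurable hmass_ne), hk]
  · linarith
  · simp only [hprod]
    exact integrable_toReal_of_lintegral_ne_top (by fun_prop) hle_ne

theorem tendsto_secondDiff_cutoffWeight (β : ℝ) (x z : ℝ^N) :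
    Tendsto (fun R => secondDiff (cutoffWeight β R) x z) atTop
      (𝓝 (secondDiff (weightPsi β) x z)) :=
  ((tendsto_cutoffWeight β _).add (tendsto_cutoffWeight β _)).sub
    ((tendsto_cutoffWeight β x).const_mul 2)

theorem exists_abs_secondDiff_weightPsi_mul_le (N : ℕ) (hs : 0 ≤ s) (hβ : -2 ≤ β) :
    ∃ D, 0 ≤ D ∧ ∀ x z : ℝ^N, |secondDiff (weightPsi β) x z| * ‖z‖ ^ (-((N : ℝ) + 2 * s)) ≤
      D * weightMajorant s β x z := by
  obtain ⟨D, hD₀, hD⟩ := exists_abs_secondDiff_cutoffWeight_mul_le N hs hβ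
  refine ⟨D, hD₀, fun x z => le_of_tendsto
    ((tendsto_secondDiff_cutoffWeight β x z).abs.mul_const _) ?_⟩
  filter_upwards [eventually_ge_atTop 1] with R hR using hD R hR x z

theorem jumpOperator_norm_rpow_weightPsi_nonpos (hN : 1 ≤ N) (hs₀ : 0 < s) (hs₁ : s < 1)
    (hβ : 0 < β) (hβN : β ≤ N - 2 * s) (x : ℝ^N) :
    jumpOperator (fun z => ‖z‖ ^ (-((N : ℝ) + 2 * s))) (weightPsi β) x ≤ 0 := by
  have := nontrivial_euclideanSpace hN
  have hne : ∀ᵐ z : ℝ^N, z ≠ 0 := Measure.ae_ne volume 0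
  obtain ⟨D, -, hD⟩ := exists_abs_secondDiff_weightPsi_mul_le N hs₀.le (by linarith : -2 ≤ β)
  obtain ⟨_, -, hmaj⟩ := exists_integral_weightMajorant_le hN hs₀ hs₁ le_rfl
    (hasTailDecay_add hN hs₀ (by linarith : -2 * s < β) (by linarith))
  have hc := subordinationConst_pos N hs₀
  set c := subordinationConst N s
  have hlim : Tendsto (fun ε => jumpOperator (subordinatedKernel s ε) (weightPsi β) x) (𝓝[>] 0)
      (𝓝 (∫ z, secondDiff (weightPsi β) x z * (c * ‖z‖ ^ (-((N : ℝ) + 2 * s))))) := by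
    refine tendsto_integral_filter_of_dominated_convergence
      (fun z => c * (D * weightMajorant s β x z)) (.of_forall fun ε => ?_) ?_
      (((hmaj x).1.const_mul D).const_mul c) ?_
    · exact ((continuous_secondDiff (continuous_weightPsi β) x).measurable.mul
        (measurable_subordinatedKernel s ε)).aestronglyMeasurable
    · filter_upwards [self_mem_nhdsWithin] with ε (hε : 0 < ε)
      filter_upwards [hne] with z hz
      rw [Real.norm_eq_abs, abs_mul, abs_of_nonneg (a := subordinatedKernel s ε z)
        ENNReal.toReal_nonneg]
      grw [subordinatedKernel_le hs₀ hε.le hz, ← hD x z]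
      exact (mul_left_comm _ _ _).le
    · filter_upwards [hne] with z hz using (tendsto_subordinatedKernel hs₀ hz).const_mul _
  have hle := le_of_tendsto hlim <| by
    filter_upwards [self_mem_nhdsWithin] with ε hε
      using jumpOperator_subordinatedKernel_weightPsi_nonpos hs₀ hβ hβN hε x
  simp only [mul_left_comm _ c, integral_const_mul] at hle
  exact nonpos_of_mul_nonpos_right hle hc

end Superharmonic

section Kato

variable {N : ℕ} {s p h : ℝ} {φ ρ c u : ℝ^N → ℝ}

theorem IsClassicalSolution.exists_integrable_bound (hu : IsClassicalSolution s ρ c u)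
    (hN : 1 ≤ N) (hs₀ : 0 < s) (hs₁ : s < 1) (hp : 1 ≤ p) (hφ : Continuous φ)
    (hφc : HasCompactSupport φ) :
    ∃ g : ℝ^N → ℝ, Integrable g ∧ ∀ h, 0 < h → h ≤ 1 → ∀ x,
      |φ x * (powSubgradient p (u x) * mixedTrunc s h u x)| ≤ g x := by
  obtain ⟨R, hR₀, hR⟩ := hφc.isCompact.isBounded.subset_closedBall_lt 0 0
  obtain ⟨U, hU⟩ := (isCompact_closedBall (0 : ℝ^N) R).exists_bound_of_continuousOn
    hu.contDiff.continuous.continuousOn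
  obtain ⟨M, hM⟩ := hu.memLs.exists_abs_mixedTrunc_le hN hs₀ hs₁ hu.contDiff hR₀.le
  refine ⟨fun x => |φ x| * (p * U ^ (p - 1) * M),
    (hφ.integrable_of_hasCompactSupport hφc).abs.mul_const _, fun h hh₀ hh₁ x => ?_⟩
  rcases eq_or_ne (φ x) 0 with hx | hx
  · simp [hx]
  have hxR := hR (subset_tsupport φ hx)
  have hsub := abs_powSubgradient_le hp (hU x hxR)
  rw [abs_mul, abs_mul]
  exact mul_le_mul_of_nonneg_left (mul_le_mul hsub (hM h x hh₀ hh₁ (mem_closedBall_zero_iff.1 hxR))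
    (abs_nonneg _) ((abs_nonneg _).trans hsub)) (abs_nonneg _)

theorem IsClassicalSolution.tendsto_powSubgradient_mul_mixedTrunc
    (hu : IsClassicalSolution s ρ c u) (hN : 1 ≤ N) (hs : 0 < s) (hp : p ≠ 0) (x : ℝ^N) :
    Tendsto (fun h => powSubgradient p (u x) * mixedTrunc s h u x) (𝓝[>] 0)
      (𝓝 (p * (ρ x * c x) * |u x| ^ p)) := by
  obtain ⟨ℓ, hℓ, heq⟩ := hu.equation x
  have hvalue : p * (ρ x * c x) * |u x| ^ p =
      powSubgradient p (u x) * ((Laplacian.laplacian u : ℝ^N → ℝ) x - ℓ) := by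
    rw [sub_eq_zero.1 heq]
    linear_combination -(ρ x * c x) * powSubgradient_mul_self hp (u x)
  rw [hvalue]
  exact (tendsto_mixedTrunc hN hs hu.contDiff hu.memLs hℓ).const_mul _

theorem aestronglyMeasurable_mul_powSubgradient_mul_mixedTrunc (hφ : Continuous φ)
    (hu : Continuous u) (p s h : ℝ) :
    AEStronglyMeasurable fun x => φ x * (powSubgradient p (u x) * mixedTrunc s h u x) :=
  (hφ.measurable.mul (((measurable_powSubgradient p).comp hu.measurable).mul
    (stronglyMeasurable_mixedTrunc hu s h).measurable)).aestronglyMeasurable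

theorem IsClassicalSolution.tendsto_integral_mul_mixedTrunc (hu : IsClassicalSolution s ρ c u)
    (hN : 1 ≤ N) (hs₀ : 0 < s) (hs₁ : s < 1) (hp : 1 ≤ p) (hφ : Continuous φ)
    (hφc : HasCompactSupport φ) :
    Integrable (fun x => φ x * (p * (ρ x * c x) * |u x| ^ p)) ∧
      Tendsto (fun h => ∫ x, φ x * (powSubgradient p (u x) * mixedTrunc s h u x)) (𝓝[>] 0)
        (𝓝 (∫ x, φ x * (p * (ρ x * c x) * |u x| ^ p))) := by
  obtain ⟨g, hg, hbound⟩ := hu.exists_integrable_bound hN hs₀ hs₁ hp hφ hφc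
  have hmeas := aestronglyMeasurable_mul_powSubgradient_mul_mixedTrunc hφ
    hu.contDiff.continuous p s
  have hlim (x) := (hu.tendsto_powSubgradient_mul_mixedTrunc hN hs₀ (by positivity : p ≠ 0)
    x).const_mul (φ x)
  have hsmall : ∀ᶠ h in 𝓝[>] (0 : ℝ), ∀ x,
      ‖φ x * (powSubgradient p (u x) * mixedTrunc s h u x)‖ ≤ g x := by
    filter_upwards [Ioc_mem_nhdsGT one_pos] with h hh using hbound h hh.1 hh.2
  refine ⟨hg.mono' (aestronglyMeasurable_of_tendsto_ae (𝓝[>] (0 : ℝ)) hmeas (.of_forall hlim))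
    (.of_forall fun x => le_of_tendsto (hlim x).norm (hsmall.mono fun h hh => hh x)), ?_⟩
  exact tendsto_integral_filter_of_dominated_convergence g (.of_forall hmeas)
    (hsmall.mono fun h hh => .of_forall hh) hg (.of_forall hlim)

theorem IsClassicalSolution.integral_mul_mixedTrunc_le (hu : IsClassicalSolution s ρ c u)
    (hN : 1 ≤ N) (hs₀ : 0 < s) (hs₁ : s < 1) (hp : 1 ≤ p) (hws : MemLs s fun x => |u x| ^ p)
    (hφ : Continuous φ) (hφc : HasCompactSupport φ) (hφ₀ : ∀ x, 0 ≤ φ x) (hh₀ : 0 < h)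
    (hh₁ : h ≤ 1) :
    ∫ x, φ x * (powSubgradient p (u x) * mixedTrunc s h u x) ≤
      ∫ x, |u x| ^ p * mixedTrunc s h φ x := by
  have huc := hu.contDiff.continuous
  obtain ⟨g, hg, hbound⟩ := hu.exists_integrable_bound hN hs₀ hs₁ hp hφ hφc
  obtain ⟨hφw, -, hsymm⟩ := hws.integrable_mul_mixedTrunc hN hs₀ hh₀ hφ hφc
    (huc.abs.rpow_const fun _ => .inr (by positivity))
  rw [← hsymm]
  refine integral_mono (hg.mono' (aestronglyMeasurable_mul_powSubgradient_mul_mixedTrunc hφ huc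
    p s h) (.of_forall (hbound h hh₀ hh₁))) hφw fun x => ?_
  exact mul_le_mul_of_nonneg_left
    (powSubgradient_mul_mixedTrunc_le hp hN hs₀ hs₁ hh₀ huc hu.memLs hws x) (hφ₀ x)

end Kato

section WeightedJumps

variable {N : ℕ} {s β σ h R : ℝ} {w : ℝ^N → ℝ}

theorem truncKernel_zero (s : ℝ) :
    (truncKernel s 0 : ℝ^N → ℝ) = fun z => ‖z‖ ^ (-((N : ℝ) + 2 * s)) :=
  funext fun z => truncKernel_of_le (norm_nonneg z)

theorem tendsto_truncKernel (s : ℝ) {z : ℝ^N} (hz : z ≠ 0) :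
    Tendsto (fun h => truncKernel s h z) (𝓝[>] 0) (𝓝 (truncKernel s 0 z)) := by
  refine tendsto_const_nhds.congr' ?_
  filter_upwards [Ioc_mem_nhdsGT (norm_pos_iff.2 hz)] with h hh
  rw [truncKernel_of_le hh.2, truncKernel_of_le (norm_nonneg z)]

theorem tendsto_integral_mul_jumpOperator {ι : Type*} {l : Filter ι} [l.IsCountablyGenerated]
    {k f : ι → ℝ^N → ℝ} {k₀ f₀ G : ℝ^N → ℝ} {F : ℝ^N → ℝ^N → ℝ} (hw : AEStronglyMeasurable w)
    (hk : ∀ i, Measurable (k i)) (hf : ∀ i, Continuous (f i)) (hF : ∀ x, Integrable (F x))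
    (hFG : ∀ x, ∫ z, F x z ≤ G x) (hwG : Integrable fun x => |w x| * G x)
    (hdom : ∀ᶠ i in l, ∀ x z, |secondDiff (f i) x z * k i z| ≤ F x z)
    (hlim : ∀ x, ∀ᵐ z, Tendsto (fun i => secondDiff (f i) x z * k i z) l
      (𝓝 (secondDiff f₀ x z * k₀ z))) :
    (∀ᶠ i in l, Integrable fun x => w x * jumpOperator (k i) (f i) x) ∧
      Tendsto (fun i => ∫ x, w x * jumpOperator (k i) (f i) x) l
        (𝓝 (∫ x, w x * jumpOperator k₀ f₀ x)) := by
  have hmeas (i) : AEStronglyMeasurable fun x => w x * jumpOperator (k i) (f i) x :=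
    hw.mul (stronglyMeasurable_jumpOperator (hk i) (hf i)).aestronglyMeasurable
  have hbound : ∀ᶠ i in l, ∀ x, ‖w x * jumpOperator (k i) (f i) x‖ ≤ |w x| * G x := by
    filter_upwards [hdom] with i hi x
    rw [norm_mul, Real.norm_eq_abs]
    gcongr
    exact (norm_integral_le_of_norm_le (hF x) (.of_forall (hi x))).trans (hFG x)
  refine ⟨hbound.mono fun i hi => hwG.mono' (hmeas i) (.of_forall hi),
    tendsto_integral_filter_of_dominated_convergence _ (.of_forall hmeas)
      (hbound.mono fun i hi => .of_forall hi) hwG (.of_forall fun x => .const_mul _ ?_)⟩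
  exact tendsto_integral_filter_of_dominated_convergence (F x)
    (.of_forall fun i => ((continuous_secondDiff (hf i) x).measurable.mul
      (hk i)).aestronglyMeasurable)
    (hdom.mono fun i hi => .of_forall (hi x)) (hF x) (hlim x)

theorem exists_abs_secondDiff_cutoffWeight_mul_truncKernel_le (N : ℕ) (hs : 0 ≤ s)
    (hβ : -2 ≤ β) :
    ∃ D, 0 ≤ D ∧ ∀ R, 1 ≤ R → ∀ (h : ℝ) (x z : ℝ^N),
      |secondDiff (cutoffWeight β R) x z * truncKernel s h z| ≤ D * weightMajorant s β x z := by
  obtain ⟨D, hD₀, hD⟩ := exists_abs_secondDiff_cutoffWeight_mul_le N hs hβ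
  refine ⟨D, hD₀, fun R hR h x z => (hD R hR x z).trans' ?_⟩
  rw [abs_mul, abs_of_nonneg (truncKernel_nonneg s h z)]
  gcongr
  exact truncKernel_le s h z

theorem tendsto_integral_mul_jumpOperator_cutoffWeight (hN : 1 ≤ N) (hs₀ : 0 < s) (hs₁ : s < 1)
    (hβ : -2 ≤ β) (htail : HasTailDecay N s β β) (hw : AEStronglyMeasurable w)
    (hwψ : Integrable fun x => |w x| * weightPsi β x) :
    (∀ R, 1 ≤ R →
      (∀ᶠ h in 𝓝[>] (0 : ℝ),
        Integrable fun x => w x * jumpOperator (truncKernel s h) (cutoffWeight β R) x) ∧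
      Tendsto (fun h => ∫ x, w x * jumpOperator (truncKernel s h) (cutoffWeight β R) x) (𝓝[>] 0)
        (𝓝 (∫ x, w x * jumpOperator (truncKernel s 0) (cutoffWeight β R) x))) ∧
      Tendsto (fun R => ∫ x, w x * jumpOperator (truncKernel s 0) (cutoffWeight β R) x) atTop
        (𝓝 (∫ x, w x * jumpOperator (truncKernel s 0) (weightPsi β) x)) := by
  have := nontrivial_euclideanSpace hN
  have hne : ∀ᵐ z : ℝ^N, z ≠ 0 := Measure.ae_ne volume 0
  obtain ⟨D, hD₀, hD⟩ := exists_abs_secondDiff_cutoffWeight_mul_truncKernel_le N hs₀.le hβ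
  obtain ⟨E, -, hE⟩ := exists_integral_weightMajorant_le hN hs₀ hs₁ (by linarith) htail
  have hF (x : ℝ^N) : Integrable fun z => D * weightMajorant s β x z := (hE x).1.const_mul D
  have hFG (x : ℝ^N) : ∫ z, D * weightMajorant s β x z ≤ D * E * weightPsi β x := by
    rw [integral_const_mul, mul_assoc]
    exact mul_le_mul_of_nonneg_left (hE x).2 hD₀
  have hwG : Integrable fun x => |w x| * (D * E * weightPsi β x) := by
    simpa only [mul_left_comm] using hwψ.const_mul (D * E)
  refine ⟨fun R hR => tendsto_integral_mul_jumpOperator hw (measurable_truncKernel s)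
    (fun _ => continuous_cutoffWeight β R) hF hFG hwG (.of_forall fun h => hD R hR h) fun x => ?_,
    (tendsto_integral_mul_jumpOperator hw (fun _ => measurable_truncKernel s 0)
      (continuous_cutoffWeight β) hF hFG hwG ?_ fun x => ?_).2⟩
  · filter_upwards [hne] with z hz using (tendsto_truncKernel s hz).const_mul _
  · filter_upwards [eventually_ge_atTop 1] with R hR using hD R hR 0
  · exact .of_forall fun z => (tendsto_secondDiff_cutoffWeight β x z).mul_const _

theorem exists_mixedTrunc_cutoffWeight_le (N : ℕ) (s : ℝ) (hβ : -2 ≤ β) :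
    ∃ A, 0 ≤ A ∧ ∀ R, 1 ≤ R → ∀ h, 0 < h → h ≤ 1 / 2 → ∀ x : ℝ^N,
      mixedTrunc s h (cutoffWeight β R) x ≤ A * weightPsi (β + 2) x +
        fracLaplacianConst N s / 2 * jumpOperator (truncKernel s h) (cutoffWeight β R) x := by
  obtain ⟨A, hA₀, hA⟩ := exists_abs_secondDiff_cutoffWeight_le N hβ
  refine ⟨N * A, by positivity, fun R hR h hh₀ hh x => add_le_add_left ?_ _⟩
  rw [mul_assoc]
  refine (le_abs_self _).trans (abs_discreteLaplacian_le hh₀ hh fun z hz => hA R hR x z ?_)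
  linarith [one_le_japaneseBracket x]

theorem exists_jumpOperator_weightPsi_le (hN : 1 ≤ N) (hs₀ : 0 < s) (hs₁ : s < 1) (hβ : -2 ≤ β)
    (hσ : σ ≤ β + 2 * s) (htail : HasTailDecay N s β σ) :
    ∃ D, 0 ≤ D ∧ ∀ x : ℝ^N,
      jumpOperator (truncKernel s 0) (weightPsi β) x ≤ D * weightPsi σ x := by
  obtain ⟨D, hD₀, hD⟩ := exists_abs_secondDiff_weightPsi_mul_le N hs₀.le hβ
  obtain ⟨E, hE₀, hE⟩ := exists_integral_weightMajorant_le hN hs₀ hs₁ hσ htail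
  refine ⟨D * E, by positivity, fun x => ?_⟩
  rw [mul_assoc]
  grw [← (hE x).2, ← integral_const_mul]
  refine (Real.le_norm_self _).trans (norm_integral_le_of_norm_le ((hE x).1.const_mul D)
    (.of_forall fun z => ?_))
  rw [Real.norm_eq_abs, abs_mul, abs_of_nonneg (truncKernel_nonneg s 0 z)]
  exact (mul_le_mul_of_nonneg_left (truncKernel_le s 0 z) (abs_nonneg _)).trans (hD x z)

end WeightedJumps

section Liouville

variable {N : ℕ} {s α β κ p A R : ℝ} {ρ c u : ℝ^N → ℝ}

theorem MemWeightedLp.integrable_abs_rpow_mul {v f : ℝ^N → ℝ} (hf : MemWeightedLp p f v) :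
    Integrable fun x => |(|v x| ^ p)| * f x := by
  simp only [Real.abs_rpow_of_nonneg (abs_nonneg _), abs_abs]
  exact hf

theorem MemWeightedLp.integrable_mul_of_abs_le {v f g : ℝ^N → ℝ} (hf : MemWeightedLp p f v)
    (hv : Continuous v) (hp : 0 ≤ p) (hg : AEStronglyMeasurable g) (hgf : ∀ x, |g x| ≤ f x) :
    Integrable fun x => |v x| ^ p * g x := by
  have hmeas := (hv.abs.rpow_const fun _ => .inr hp).aestronglyMeasurable (μ := volume)
  refine Integrable.mono' hf (hmeas.mul hg) (.of_forall fun x => ?_)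
  rw [norm_mul, Real.norm_of_nonneg (by positivity)]
  exact mul_le_mul_of_nonneg_left (hgf x) (by positivity)

theorem MemWeightedLp.mono_weightPsi {v : ℝ^N → ℝ} {σ : ℝ} (hβ : MemWeightedLp p (weightPsi β) v)
    (hv : Continuous v) (hp : 0 ≤ p) (hσ : β ≤ σ) : MemWeightedLp p (weightPsi σ) v :=
  hβ.integrable_mul_of_abs_le hv hp (continuous_weightPsi σ).aestronglyMeasurable fun x =>
    (abs_of_pos (weightPsi_pos σ x)).trans_le (weightPsi_antitone x hσ)

theorem IsClassicalSolution.integral_cutoffWeight_mul_le (hu : IsClassicalSolution s ρ c u)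
    (hN : 1 ≤ N) (hs₀ : 0 < s) (hs₁ : s < 1) (hβ : -2 ≤ β) (htail : HasTailDecay N s β β)
    (hp : 1 ≤ p) (hws : MemLs s fun x => |u x| ^ p) (hwψ : MemWeightedLp p (weightPsi β) u)
    (hR : 1 ≤ R) (hA : ∀ h, 0 < h → h ≤ 1 / 2 → ∀ x : ℝ^N,
      mixedTrunc s h (cutoffWeight β R) x ≤ A * weightPsi (β + 2) x +
        fracLaplacianConst N s / 2 * jumpOperator (truncKernel s h) (cutoffWeight β R) x) :
    ∫ x, cutoffWeight β R x * (p * (ρ x * c x) * |u x| ^ p) ≤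
      A * (∫ x, |u x| ^ p * weightPsi (β + 2) x) + fracLaplacianConst N s / 2 *
        ∫ x, |u x| ^ p * jumpOperator (truncKernel s 0) (cutoffWeight β R) x := by
  have huc := hu.contDiff.continuous
  have hw : Continuous fun x => |u x| ^ p := huc.abs.rpow_const fun _ => .inr (by positivity)
  have hwψ₂ : Integrable fun x => |u x| ^ p * weightPsi (β + 2) x :=
    hwψ.mono_weightPsi huc (by positivity) (by linarith)
  have hφ := continuous_cutoffWeight (N := N) β R
  have hφc := hasCompactSupport_cutoffWeight (N := N) β (one_pos.trans_le hR)
  obtain ⟨hint, hlim⟩ := (tendsto_integral_mul_jumpOperator_cutoffWeight hN hs₀ hs₁ hβ htail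
    hw.aestronglyMeasurable hwψ.integrable_abs_rpow_mul).1 R hR
  refine le_of_tendsto_of_tendsto
    (hu.tendsto_integral_mul_mixedTrunc hN hs₀ hs₁ hp hφ hφc).2
    ((hlim.const_mul (fracLaplacianConst N s / 2)).const_add _) ?_
  filter_upwards [hint, Ioc_mem_nhdsGT one_half_pos] with h hinth hh
  refine (hu.integral_mul_mixedTrunc_le hN hs₀ hs₁ hp hws hφ hφc (cutoffWeight_nonneg β R) hh.1
    (hh.2.trans (by norm_num))).trans ?_
  rw [← integral_const_mul, ← integral_const_mul,
    ← integral_add (hwψ₂.const_mul A) (hinth.const_mul _)]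
  refine integral_mono (hws.integrable_mul_mixedTrunc hN hs₀ hh.1 hφ hφc hw).2.1
    ((hwψ₂.const_mul A).add (hinth.const_mul _)) fun x => ?_
  have hmul := mul_le_mul_of_nonneg_left (hA h hh.1 hh.2 x) (by positivity : 0 ≤ |u x| ^ p)
  simp only
  linarith

theorem abs_weightPsi_mul_cutoffWeight_le (α β : ℝ) (hR : 0 ≤ R) (x : ℝ^N) :
    |weightPsi α x * cutoffWeight β R x| ≤ weightPsi (α + β) x := by
  rw [abs_of_nonneg (mul_nonneg (weightPsi_pos α x).le (cutoffWeight_nonneg β R x)), weightPsi_add]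
  exact mul_le_mul_of_nonneg_left (cutoffWeight_le_weightPsi β hR x) (weightPsi_pos α x).le

theorem MemWeightedLp.tendsto_integral_mul_cutoffWeight (hwψ : MemWeightedLp p (weightPsi β) u)
    (hu : Continuous u) (hp : 0 ≤ p) (hα : 0 ≤ α) :
    Tendsto (fun R => ∫ x, |u x| ^ p * (weightPsi α x * cutoffWeight β R x)) atTop
      (𝓝 (∫ x, |u x| ^ p * weightPsi (α + β) x)) := by
  have hw : Continuous fun x => |u x| ^ p := hu.abs.rpow_const fun _ => .inr hp
  refine tendsto_integral_filter_of_dominated_convergence _ (.of_forall fun R => (hw.mul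
    ((continuous_weightPsi α).mul (continuous_cutoffWeight β R))).aestronglyMeasurable) ?_
    (hwψ.mono_weightPsi hu hp (le_add_of_nonneg_left hα)) (.of_forall fun x => ?_)
  · filter_upwards [eventually_ge_atTop 0] with R hR
    refine .of_forall fun x => ?_
    rw [norm_mul, Real.norm_of_nonneg (by positivity)]
    exact mul_le_mul_of_nonneg_left (abs_weightPsi_mul_cutoffWeight_le α β hR x) (by positivity)
  · rw [weightPsi_add]
    exact ((tendsto_cutoffWeight β x).const_mul _).const_mul _

theorem IsClassicalSolution.mul_integral_weightPsi_le (hu : IsClassicalSolution s ρ c u)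
    (hN : 1 ≤ N) (hs₀ : 0 < s) (hs₁ : s < 1) (hα : 0 ≤ α) (hβ : -2 ≤ β)
    (htail : HasTailDecay N s β β) (hρc : ∀ x, κ * weightPsi α x ≤ ρ x * c x) (hp : 1 ≤ p)
    (hws : MemLs s fun x => |u x| ^ p) (hwψ : MemWeightedLp p (weightPsi β) u)
    (hA : ∀ R, 1 ≤ R → ∀ h, 0 < h → h ≤ 1 / 2 → ∀ x : ℝ^N,
      mixedTrunc s h (cutoffWeight β R) x ≤ A * weightPsi (β + 2) x +
        fracLaplacianConst N s / 2 * jumpOperator (truncKernel s h) (cutoffWeight β R) x) :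
    p * κ * (∫ x, |u x| ^ p * weightPsi (α + β) x) ≤
      A * (∫ x, |u x| ^ p * weightPsi (β + 2) x) + fracLaplacianConst N s / 2 *
        ∫ x, |u x| ^ p * jumpOperator (truncKernel s 0) (weightPsi β) x := by
  have huc := hu.contDiff.continuous
  have hw : Continuous fun x => |u x| ^ p := huc.abs.rpow_const fun _ => .inr (by positivity)
  have hlim := hwψ.tendsto_integral_mul_cutoffWeight huc (by positivity) hα
  have hjump := (tendsto_integral_mul_jumpOperator_cutoffWeight hN hs₀ hs₁ hβ htail
    hw.aestronglyMeasurable hwψ.integrable_abs_rpow_mul).2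
  refine le_of_tendsto_of_tendsto (hlim.const_mul (p * κ))
    ((hjump.const_mul (fracLaplacianConst N s / 2)).const_add _) ?_
  filter_upwards [eventually_ge_atTop 1] with R hR
  refine le_trans ?_ (hu.integral_cutoffWeight_mul_le hN hs₀ hs₁ hβ htail hp hws hwψ hR (hA R hR))
  rw [← integral_const_mul]
  have hcut : Integrable fun x => |u x| ^ p * (weightPsi α x * cutoffWeight β R x) :=
    (hwψ.mono_weightPsi huc (by positivity) (le_add_of_nonneg_left hα)).integrable_mul_of_abs_le
      huc (by positivity)
      ((continuous_weightPsi α).mul (continuous_cutoffWeight β R)).aestronglyMeasurable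
      (abs_weightPsi_mul_cutoffWeight_le α β (by positivity))
  refine integral_mono (hcut.const_mul _)
    (hu.tendsto_integral_mul_mixedTrunc hN hs₀ hs₁ hp (continuous_cutoffWeight β R)
      (hasCompactSupport_cutoffWeight β (by positivity))).1 fun x => ?_
  have hmul := mul_le_mul_of_nonneg_left (hρc x)
    (mul_nonneg (cutoffWeight_nonneg β R x) (by positivity : 0 ≤ p * |u x| ^ p))
  linarith

theorem eq_zero_of_integral_rpow_mul_weightPsi_nonpos (hu : Continuous u) (hp : 0 < p) {σ : ℝ}
    (hint : MemWeightedLp p (weightPsi σ) u) (hle : ∫ x, |u x| ^ p * weightPsi σ x ≤ 0) (x : ℝ^N) :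
    u x = 0 := by
  have hnonneg (x) : 0 ≤ |u x| ^ p * weightPsi σ x :=
    mul_nonneg (by positivity) (weightPsi_pos σ x).le
  have hcont : Continuous fun x => |u x| ^ p * weightPsi σ x :=
    (hu.abs.rpow_const fun _ => .inr hp.le).mul (continuous_weightPsi σ)
  have hzero := (integral_eq_zero_iff_of_nonneg hnonneg hint).1
    (hle.antisymm (integral_nonneg hnonneg))
  have hx := congr_fun ((hcont.ae_eq_iff_eq volume continuous_zero).1 hzero) x
  simpa [(weightPsi_pos σ x).ne', Real.rpow_eq_zero, hp.ne'] using hx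

theorem exists_forall_eq_zero_of_jumpOperator_weightPsi_le (hN : 1 ≤ N) (hs₀ : 0 < s) (hs₁ : s < 1)
    (hα₀ : 0 ≤ α) (hα₂ : α ≤ 2) (hβ : -2 ≤ β) (htail : HasTailDecay N s β β)
    (hjump : ∃ D, 0 ≤ D ∧ ∀ x : ℝ^N,
      jumpOperator (truncKernel s 0) (weightPsi β) x ≤ D * weightPsi (α + β) x) :
    ∃ K, ∀ (ρ c : ℝ^N → ℝ) (κ : ℝ), (∀ x, κ * weightPsi α x ≤ ρ x * c x) →
      ∀ p, 1 ≤ p → K ≤ p * κ → ∀ u, IsClassicalSolution s ρ c u →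
        MemLs s (fun x => |u x| ^ p) → MemWeightedLp p (weightPsi β) u → ∀ x, u x = 0 := by
  obtain ⟨A, hA₀, hA⟩ := exists_mixedTrunc_cutoffWeight_le N s hβ
  obtain ⟨D, hD₀, hD⟩ := hjump
  refine ⟨A + fracLaplacianConst N s / 2 * D + 1, fun ρ c κ hρc p hp hK u hu hws hwψ => ?_⟩
  have huc := hu.contDiff.continuous
  have hdom : MemWeightedLp p (weightPsi (α + β)) u :=
    hwψ.mono_weightPsi huc (by positivity) (by linarith)
  set I := ∫ x, |u x| ^ p * weightPsi (α + β) x with hI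
  have hI₀ : 0 ≤ I := integral_nonneg fun x => mul_nonneg (by positivity) (weightPsi_pos _ x).le
  have hlocal : ∫ x, |u x| ^ p * weightPsi (β + 2) x ≤ I :=
    integral_mono (hwψ.mono_weightPsi huc (by positivity) (by linarith)) hdom fun x =>
      mul_le_mul_of_nonneg_left (weightPsi_antitone x (by linarith)) (by positivity)
  have hnonlocal :
      ∫ x, |u x| ^ p * jumpOperator (truncKernel s 0) (weightPsi β) x ≤ D * I := by
    by_cases hint : Integrable fun x => |u x| ^ p * jumpOperator (truncKernel s 0) (weightPsi β) x
    · rw [hI, ← integral_const_mul]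
      refine integral_mono hint (hdom.const_mul D) fun x => ?_
      simpa only [mul_left_comm] using mul_le_mul_of_nonneg_left (hD x) (by positivity)
    · rw [integral_undef hint]
      positivity
  have hmain := hu.mul_integral_weightPsi_le hN hs₀ hs₁ hα₀ hβ htail hρc hp hws hwψ hA
  have _hconst := fracLaplacianConst_pos N hs₀ hs₁
  grw [← hK, hlocal, hnonlocal] at hmain
  exact eq_zero_of_integral_rpow_mul_weightPsi_nonpos huc (by positivity) hdom (by linarith)

theorem exists_hasTailDecay_and_jumpOperator_le (hN : 1 ≤ N) (hs₀ : 0 < s) (hs₁ : s < 1)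
    (hα : 0 ≤ α)
    (hcases :
      (0 < β ∧ β ≤ (N : ℝ) - 2 * s ∧ α ≤ 2) ∨
      ((N : ℝ) - 2 * s < β ∧ β < (N : ℝ) ∧ α ≤ 2 * s) ∨
      (β = (N : ℝ) ∧ α < 2 * s) ∨
      ((N : ℝ) < β ∧ α + β ≤ 2 * s + (N : ℝ))) :
    HasTailDecay N s β β ∧ ∃ D, 0 ≤ D ∧ ∀ x : ℝ^N,
      jumpOperator (truncKernel s 0) (weightPsi β) x ≤ D * weightPsi (α + β) x := by
  have hN' : (1 : ℝ) ≤ N := by exact_mod_cast hN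
  have of_tail (hβ : -2 ≤ β) (hα' : α ≤ 2 * s) (htail : HasTailDecay N s β (α + β)) :
      HasTailDecay N s β β ∧ ∃ D, 0 ≤ D ∧ ∀ x : ℝ^N,
        jumpOperator (truncKernel s 0) (weightPsi β) x ≤ D * weightPsi (α + β) x :=
    ⟨htail.mono (by linarith),
      exists_jumpOperator_weightPsi_le hN hs₀ hs₁ hβ (by linarith) htail⟩
  rcases hcases with ⟨hβ₀, hβ, -⟩ | ⟨hβ₀, hβ, hα'⟩ | ⟨rfl, hα'⟩ | ⟨hβ, hαβ⟩
  · refine ⟨(hasTailDecay_add hN hs₀ (by linarith) (by linarith)).mono (by linarith), 0, le_rfl,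
      fun x => ?_⟩
    rw [truncKernel_zero, zero_mul]
    exact jumpOperator_norm_rpow_weightPsi_nonpos hN hs₀ hs₁ hβ₀ hβ x
  · exact of_tail (by linarith) hα' ((hasTailDecay_add hN hs₀ (by linarith) hβ).mono (by linarith))
  · exact of_tail (by linarith) hα'.le
      (hasTailDecay_of_le (by positivity) (by linarith) (by linarith))
  · exact of_tail (by linarith) (by linarith)
      (hasTailDecay_of_le (by linarith) (by linarith) (by linarith))

end Liouville

theorem theorem2p5_general (N : ℕ) (hN : 1 ≤ N) (s : ℝ) (hs0 : 0 < s) (hs1 : s < 1)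
    (α β : ℝ) (hα : 0 ≤ α)
    (hcases :
      (0 < β ∧ β ≤ (N : ℝ) - 2 * s ∧ α ≤ 2) ∨
      ((N : ℝ) - 2 * s < β ∧ β < (N : ℝ) ∧ α ≤ 2 * s) ∨
      (β = (N : ℝ) ∧ α < 2 * s) ∨
      ((N : ℝ) < β ∧ α + β ≤ 2 * s + (N : ℝ))) :
    ∃ K : ℝ, ∀ (ρ c : ℝ^N → ℝ) (κ : ℝ), (∀ x, κ * weightPsi α x ≤ ρ x * c x) →
      ∀ p : ℝ, 1 ≤ p → K ≤ p * κ → ∀ u : ℝ^N → ℝ, IsClassicalSolution s ρ c u →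
        MemLs s (fun x => |u x| ^ p) → MemWeightedLp p (weightPsi β) u → ∀ x, u x = 0 := by
  have hN' : (1 : ℝ) ≤ N := by exact_mod_cast hN
  obtain ⟨htail, hjump⟩ := exists_hasTailDecay_and_jumpOperator_le hN hs0 hs1 hα hcases
  exact exists_forall_eq_zero_of_jumpOperator_weightPsi_le hN hs0 hs1 hα
    (by rcases hcases with h | h | h | h <;> linarith)
    (by rcases hcases with h | h | h | h <;> linarith) htail hjump

theorem theorem2p5 (N : ℕ) (hN : 1 ≤ N) (s : ℝ) (hs0 : 0 < s) (hs1 : s < 1)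
    (α β C₀ : ℝ) (hα : 0 ≤ α) (hC₀ : 0 < C₀)
    (hcases :
      (0 < β ∧ β ≤ (N : ℝ) - 2 * s ∧ α ≤ 2) ∨
      ((N : ℝ) - 2 * s < β ∧ β < (N : ℝ) ∧ α ≤ 2 * s) ∨
      (β = (N : ℝ) ∧ α < 2 * s) ∨
      ((N : ℝ) < β ∧ α + β ≤ 2 * s + (N : ℝ))) :
    ∃ K : ℝ, ∀ (ρ c : EuclideanSpace ℝ (Fin N) → ℝ), Continuous ρ →
      (∀ x, C₀ * (1 + ‖x‖ ^ 2) ^ (-α / 2) ≤ ρ x) →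
      Continuous c →
      ∀ c₀ : ℝ, 0 < c₀ → (∀ x, c₀ ≤ c x) →
      ∀ p : ℝ, 1 ≤ p → K ≤ p * c₀ →
      ∀ u : EuclideanSpace ℝ (Fin N) → ℝ, IsClassicalSolution s ρ c u →
        MemLs s (fun x => |u x| ^ p) →
        MemWeightedLp p (weightPsi β) u →
        ∀ x, u x = 0 := by
  obtain ⟨K, hK⟩ := theorem2p5_general N hN s hs0 hs1 α β hα hcases
  refine ⟨K / C₀, fun ρ c _ hρ _ c₀ hc₀ hc p hp hKp => hK ρ c (C₀ * c₀) (fun x => ?_) p hp ?_⟩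
  · rw [mul_right_comm]
    exact mul_le_mul (hρ x) (hc x) hc₀.le ((by positivity : (0 : ℝ) ≤ _).trans (hρ x))
  · rwa [mul_comm C₀, ← mul_assoc, ← div_le_iff₀ hC₀]
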